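/- The calculus $\lambda_{\mathrm{mon}}$ (call-by-push-value with user-defined monads and monadic reflection) is as follows. Terms. Values $V ::= x \mid () \mid (V,W) \mid \mathbf{inj}_\ell V \mid \{M\}$ (thunk); computations $M,N ::= \mathbf{case}\ V\ \mathbf{of}\ (x_1,x_2)\to M \mid \mathbf{case}\ V\ \mathbf{of}\ \{\mathbf{inj}_{\ell}\,x \to M_\ell\}_{\ell\in L} \mid V! \mid \mathbf{return}\,V \mid \mathbf{let}\ x\leftarrow M\ \mathbf{in}\ N \mid \lambda x.M \mid M\,V \mid \langle M,N\rangle \mid \mathbf{prj}_1 M \mid \mathbf{prj}_2 M \mid \mathbf{reflect}\,N \mid [N]^T$, where $L$ is a finite set of labels and $T = \mathbf{where}\ \{\mathbf{return}\ x = N_u;\ y \mathbin{>\!\!>\!\!=} f = N_b\}$ is a monad definition whose bodies are closed apart from $x$ in $N_u$ and $y,f$ in $N_b$. Reduction. Basic frames are $B ::= \mathbf{let}\ x\leftarrow[\,]\ \mathbf{in}\ N \mid [\,]\,V \mid \mathbf{prj}_i[\,]$, hoisting contexts $H ::= [\,]\mid H[B]$, evaluation contexts $\mathcal E ::= [\,]\mid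 \mathcal E[B]\mid \mathcal E[[\,]^T]$. The relation $\to$ is the closure under evaluation contexts of the usual $\beta$-rules for pairs, variants, $\{M\}!$, $\mathbf{let}$ of a $\mathbf{return}$, functions and computation pairs, together with $[\mathbf{return}\,V]^T \to N_u[V/x]$ and $[H[\mathbf{reflect}\,N]]^T \to N_b[\{N\}/y,\ \{\lambda x.[H[\mathbf{return}\,x]]^T\}/f]$. Types. $A ::= \alpha \mid 1 \mid A\times B \mid \{\mathbf{inj}_\ell A_\ell\}_{\ell\in L} \mid U_E C$ (value types), $C ::= F A \mid A\to C \mid C\mathbin{\&}D$ (computation types), $E ::= \emptyset \mid E\prec(\alpha.C)\,T$ (effects: stacks of monads; $\alpha$ is bound in $C$). The effect $\emptyset$ is well-kinded in the type environment $\Theta$; $E\prec(\alpha.C)\,T$ is, if $E$ is, $C$ is a well-kinded $E$-computation type in $\Theta,\alpha$, and $\Theta,\alpha;\,x:\alpha\vdash_E N_u : C$ and $\Theta,\alpha_1,\alpha_2;\ y: U_E C[\alpha_1/\alpha],\ f:U_E(\alpha_1\to C[\alpha_2/\alpha])\vdash_E N_b : C[\alpha_2/\alpha]$. All types, effects and environments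 occurring in typing judgements $\Theta;\Gamma\vdash V:A$ and $\Theta;\Gamma\vdash_E M:C$ must be well-kinded. The typing rules are the standard ones of call-by-push-value, where $U_EC$ is the type of thunks of $E$-computations of type $C$ and $\mathbf{return}$ is allowed at every effect $E$, with the effect annotation $E$ the same throughout $\mathbf{let}$, application, etc.; moreover $\Theta;\Gamma\vdash_{E\prec(\alpha.C)T}\mathbf{reflect}\,N : F A$ if $\Theta;\Gamma\vdash_E N : C[A/\alpha]$, and $\Theta;\Gamma\vdash_E [N]^T : C[A/\alpha]$ if $\Theta;\Gamma\vdash_{E\prec(\alpha.C)T} N : F A$. Semantics. Given an assignment $\theta$ of sets to type variables, derivations have the following partial set-theoretic semantics: $\emptyset$ denotes the identity monad; $E\prec(\alpha.C)T$ denotes the data $X\mapsto|[\![C]\!]_{\theta[\alpha\mapsto X]}|$ with the unit and the Kleisli extension denoted by $N_u$ and $N_b$; $F A$ denotes the free algebra of the monad of its effect, $A\to C$ and $C\mathbin{\&}D$ the power and product algebras, $U_EC$ the carrier of $[\![C]\!]$, the other value types the evident sets; terms denote the evident functions, $\mathbf{let}$ being interpreted through the algebra structure and $\mathbf{reflect}$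 and $[\,\cdot\,]^T$ as identities. The semantics of a derivation at $\theta$ is defined iff that of its sub-derivations (those of its kinding side conditions included) is defined and, wherever $E\prec(\alpha.C)T$ is kinded, the data above satisfies the three monad laws. A derivation is *proper* if its semantics is defined for all $\theta$; a typed term is proper if it has a proper derivation. We say that $M$ *diverges* if for every $n\in\mathbb N$ there is some $N$ with $M\to^n N$. **Theorem (termination of $\lambda_{\mathrm{mon}}$).** Let $\Theta;\emptyset\vdash_{\emptyset} M : F A$ be a proper closed returner of $\lambda_{\mathrm{mon}}$ with the empty effect. Then $M$ does not diverge, and there exists a unique closed value $V$ with $\Theta;\emptyset\vdash V : A$ such that $M\to^* \mathbf{return}\,V$. -/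

import Mathlib

/-!
The calculus of monadic reflection, in well-scoped de Bruijn syntax.
`Val m` / `Comp m` have term variables in `Fin m`, and `VTy n` / `CTy n` / `Eff n` have type
variables in `Fin n`; a binder adds the index `0`. Terms carry no type annotations.
-/

namespace LamMon

/-- Extend an assignment (of anything, to de Bruijn indices) by a value for the index `0`. -/
def scons {X : Type*} {n : ℕ} (a : X) (f : Fin n → X) : Fin (n + 1) → X :=
  Fin.cases a f

/-- Lift a renaming under a binder. -/
def liftRen {m k : ℕ} (ρ : Fin m → Fin k) : Fin (m + 1) → Fin (k + 1) :=
  scons 0 (fun i => (ρ i).succ)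

/-! ### Terms -/

mutual
  /-- Value terms. Variant constructor labels are natural numbers. -/
  inductive Val : ℕ → Type
    | var {m : ℕ} (i : Fin m) : Val m
    | unit {m : ℕ} : Val m
    | pair {m : ℕ} (V W : Val m) : Val m
    | inj {m : ℕ} (l : ℕ) (V : Val m) : Val m
    | thunk {m : ℕ} (M : Comp m) : Val m
  /-- Computation terms. -/
  inductive Comp : ℕ → Type
    /-- `case V of (x₁, x₂) → M`; in `M`, the index `0` is `x₁` and the index `1` is `x₂`. -/
    | split {m : ℕ} (V : Val m) (M : Comp (m + 2)) : Comp m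
    /-- `case V of {inj_l x → M l}`, with one branch for each label in the finite set `L`. -/
    | case {m : ℕ} (V : Val m) (L : Finset ℕ) (M : L → Comp (m + 1)) : Comp m
    | force {m : ℕ} (V : Val m) : Comp m
    | ret {m : ℕ} (V : Val m) : Comp m
    /-- `let x ← M in N` -/
    | bind {m : ℕ} (M : Comp m) (N : Comp (m + 1)) : Comp m
    | lam {m : ℕ} (M : Comp (m + 1)) : Comp m
    | app {m : ℕ} (M : Comp m) (V : Val m) : Comp m
    | cpair {m : ℕ} (M N : Comp m) : Comp m
    | fst {m : ℕ} (M : Comp m) : Comp m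
    | snd {m : ℕ} (M : Comp m) : Comp m
    | reflect {m : ℕ} (N : Comp m) : Comp m
    /-- `[N]^T` for the monad `T = where {return x = Nu; y >>= f = Nb}`. The bodies are closed
    apart from their arguments: `x` in `Nu`, and `y` (index `0`) and `f` (index `1`) in `Nb`. -/
    | reify {m : ℕ} (Nu : Comp 1) (Nb : Comp 2) (N : Comp m) : Comp m
end

mutual
  def Val.ren {m k : ℕ} (ρ : Fin m → Fin k) : Val m → Val k
    | .var i => .var (ρ i)
    | .unit => .unit
    | .pair V W => .pair (V.ren ρ) (W.ren ρ)
    | .inj l V => .inj l (V.ren ρ)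
    | .thunk M => .thunk (M.ren ρ)
  def Comp.ren {m k : ℕ} (ρ : Fin m → Fin k) : Comp m → Comp k
    | .split V M => .split (V.ren ρ) (M.ren (liftRen (liftRen ρ)))
    | .case V L M => .case (V.ren ρ) L (fun l => (M l).ren (liftRen ρ))
    | .force V => .force (V.ren ρ)
    | .ret V => .ret (V.ren ρ)
    | .bind M N => .bind (M.ren ρ) (N.ren (liftRen ρ))
    | .lam M => .lam (M.ren (liftRen ρ))
    | .app M V => .app (M.ren ρ) (V.ren ρ)
    | .cpair M N => .cpair (M.ren ρ) (N.ren ρ)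
    | .fst M => .fst (M.ren ρ)
    | .snd M => .snd (M.ren ρ)
    | .reflect N => .reflect (N.ren ρ)
    | .reify Nu Nb N => .reify Nu Nb (N.ren ρ)
end

/-- Lift a substitution of values under a binder. -/
def liftSub {m k : ℕ} (σ : Fin m → Val k) : Fin (m + 1) → Val (k + 1) :=
  scons (.var 0) (fun i => (σ i).ren Fin.succ)

mutual
  /-- Simultaneous capture-avoiding substitution in value terms. -/
  def Val.subst {m k : ℕ} (σ : Fin m → Val k) : Val m → Val k
    | .var i => σ i
    | .unit => .unit
    | .pair V W => .pair (V.subst σ) (W.subst σ)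
    | .inj l V => .inj l (V.subst σ)
    | .thunk M => .thunk (M.subst σ)
  /-- Simultaneous capture-avoiding substitution in computation terms. -/
  def Comp.subst {m k : ℕ} (σ : Fin m → Val k) : Comp m → Comp k
    | .split V M => .split (V.subst σ) (M.subst (liftSub (liftSub σ)))
    | .case V L M => .case (V.subst σ) L (fun l => (M l).subst (liftSub σ))
    | .force V => .force (V.subst σ)
    | .ret V => .ret (V.subst σ)
    | .bind M N => .bind (M.subst σ) (N.subst (liftSub σ))
    | .lam M => .lam (M.subst (liftSub σ))
    | .app M V => .app (M.subst σ) (V.subst σ)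
    | .cpair M N => .cpair (M.subst σ) (N.subst σ)
    | .fst M => .fst (M.subst σ)
    | .snd M => .snd (M.subst σ)
    | .reflect N => .reflect (N.subst σ)
    | .reify Nu Nb N => .reify Nu Nb (N.subst σ)
end

/-- `M[V/x]` for the variable `x` with index `0`. -/
def Comp.subst1 {m : ℕ} (M : Comp (m + 1)) (V : Val m) : Comp m :=
  M.subst (scons V Val.var)

/-! ### Operational semantics -/

/-- Basic frames: `let x ← [ ] in N`, `[ ] V`, and the two projections. -/
inductive BFrame (m : ℕ) : Type
  | bind (N : Comp (m + 1)) : BFrame m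
  | app (V : Val m) : BFrame m
  | fst : BFrame m
  | snd : BFrame m

def BFrame.plug {m : ℕ} (M : Comp m) : BFrame m → Comp m
  | .bind N => .bind M N
  | .app V => .app M V
  | .fst => .fst M
  | .snd => .snd M

def BFrame.ren {m k : ℕ} (ρ : Fin m → Fin k) : BFrame m → BFrame k
  | .bind N => .bind (N.ren (liftRen ρ))
  | .app V => .app (V.ren ρ)
  | .fst => .fst
  | .snd => .snd

/-- Hoisting contexts: stacks of basic frames, `H ::= [ ] | H[B[ ]]`. -/
inductive HCtx (m : ℕ) : Type
  | hole : HCtx m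
  | push (H : HCtx m) (B : BFrame m) : HCtx m

def HCtx.plug {m : ℕ} : HCtx m → Comp m → Comp m
  | .hole, M => M
  | .push H B, M => H.plug (B.plug M)

def HCtx.ren {m k : ℕ} (ρ : Fin m → Fin k) : HCtx m → HCtx k
  | .hole => .hole
  | .push H B => .push (H.ren ρ) (B.ren ρ)

/-- Evaluation contexts `E ::= [ ] | E[B[ ]] | E[[ ]^T]`. -/
inductive ECtx (m : ℕ) : Type
  | hole : ECtx m
  | push (E : ECtx m) (B : BFrame m) : ECtx m
  | reify (E : ECtx m) (Nu : Comp 1) (Nb : Comp 2) : ECtx m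

def ECtx.plug {m : ℕ} : ECtx m → Comp m → Comp m
  | .hole, M => M
  | .push E B, M => E.plug (B.plug M)
  | .reify E Nu Nb, M => E.plug (.reify Nu Nb M)

/-- The `β`-reductions. -/
inductive Beta {m : ℕ} : Comp m → Comp m → Prop
  | split (V W : Val m) (M : Comp (m + 2)) :
      Beta (.split (.pair V W) M) (M.subst (scons V (scons W Val.var)))
  | case (l : ℕ) (V : Val m) (L : Finset ℕ) (M : L → Comp (m + 1)) (hl : l ∈ L) :
      Beta (.case (.inj l V) L M) ((M ⟨l, hl⟩).subst1 V)
  | force (M : Comp m) : Beta (.force (.thunk M)) M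
  | bind (V : Val m) (N : Comp (m + 1)) : Beta (.bind (.ret V) N) (N.subst1 V)
  | app (M : Comp (m + 1)) (V : Val m) : Beta (.app (.lam M) V) (M.subst1 V)
  | fst (M N : Comp m) : Beta (.fst (.cpair M N)) M
  | snd (M N : Comp m) : Beta (.snd (.cpair M N)) N
  /-- `[return V]^T ⇝ Nu[V/x]` -/
  | reify (Nu : Comp 1) (Nb : Comp 2) (V : Val m) :
      Beta (.reify Nu Nb (.ret V)) (Nu.subst (scons V Fin.elim0))
  /-- `[H[reflect N]]^T ⇝ Nb[{N}/y, {λ x. [H[return x]]^T}/f]` -/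
  | reflect (Nu : Comp 1) (Nb : Comp 2) (H : HCtx m) (N : Comp m) :
      Beta (.reify Nu Nb (H.plug (.reflect N)))
        (Nb.subst (scons (.thunk N)
          (scons (.thunk (.lam (.reify Nu Nb ((H.ren Fin.succ).plug (.ret (.var 0))))))
            Fin.elim0)))

/-- Reduction: a `β`-reduction inside an evaluation context. -/
inductive Step {m : ℕ} : Comp m → Comp m → Prop
  | mk (E : ECtx m) {M N : Comp m} (h : Beta M N) : Step (E.plug M) (E.plug N)

/-- Reduction in exactly `k` steps. -/
def StepN {m : ℕ} : ℕ → Comp m → Comp m → Prop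
  | 0, M, N => M = N
  | k + 1, M, N => ∃ P, Step M P ∧ StepN k P N

/-- `M` diverges: it has reduction sequences of every finite length. -/
def Diverges {m : ℕ} (M : Comp m) : Prop := ∀ k : ℕ, ∃ N, StepN k M N

/-! ### Types and effects -/

mutual
  inductive VTy : ℕ → Type
    | var {n : ℕ} (a : Fin n) : VTy n
    | unit {n : ℕ} : VTy n
    | prod {n : ℕ} (A B : VTy n) : VTy n
    /-- The variant type with the labels in `L`, and arguments of type `A l` for the label `l`. -/
    | variant {n : ℕ} (L : Finset ℕ) (A : L → VTy n) : VTy n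
    /-- `U_E C`, the type of thunks of `E`-computations of type `C` -/
    | U {n : ℕ} (E : Eff n) (C : CTy n) : VTy n
  inductive CTy : ℕ → Type
    | F {n : ℕ} (A : VTy n) : CTy n
    | arr {n : ℕ} (A : VTy n) (C : CTy n) : CTy n
    | prod {n : ℕ} (C D : CTy n) : CTy n
  /-- Effects: stacks of monads. `layer E C Nu Nb` puts on top of `E` the monad with type
  constructor `α. C`, unit `Nu` and Kleisli extension `Nb`. -/
  inductive Eff : ℕ → Type
    | pure {n : ℕ} : Eff n
    | layer {n : ℕ} (E : Eff n) (C : CTy (n + 1)) (Nu : Comp 1) (Nb : Comp 2) : Eff n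
end

mutual
  def VTy.ren {n k : ℕ} (ρ : Fin n → Fin k) : VTy n → VTy k
    | .var a => .var (ρ a)
    | .unit => .unit
    | .prod A B => .prod (A.ren ρ) (B.ren ρ)
    | .variant L A => .variant L (fun l => (A l).ren ρ)
    | .U E C => .U (E.ren ρ) (C.ren ρ)
  def CTy.ren {n k : ℕ} (ρ : Fin n → Fin k) : CTy n → CTy k
    | .F A => .F (A.ren ρ)
    | .arr A C => .arr (A.ren ρ) (C.ren ρ)
    | .prod C D => .prod (C.ren ρ) (D.ren ρ)
  def Eff.ren {n k : ℕ} (ρ : Fin n → Fin k) : Eff n → Eff k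
    | .pure => .pure
    | .layer E C Nu Nb => .layer (E.ren ρ) (C.ren (liftRen ρ)) Nu Nb
end

/-- Lift a substitution of value types under a type binder. -/
def liftTSub {n k : ℕ} (σ : Fin n → VTy k) : Fin (n + 1) → VTy (k + 1) :=
  scons (.var 0) (fun a => (σ a).ren Fin.succ)

mutual
  def VTy.subst {n k : ℕ} (σ : Fin n → VTy k) : VTy n → VTy k
    | .var a => σ a
    | .unit => .unit
    | .prod A B => .prod (A.subst σ) (B.subst σ)
    | .variant L A => .variant L (fun l => (A l).subst σ)
    | .U E C => .U (E.subst σ) (C.subst σ)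
  def CTy.subst {n k : ℕ} (σ : Fin n → VTy k) : CTy n → CTy k
    | .F A => .F (A.subst σ)
    | .arr A C => .arr (A.subst σ) (C.subst σ)
    | .prod C D => .prod (C.subst σ) (D.subst σ)
  def Eff.subst {n k : ℕ} (σ : Fin n → VTy k) : Eff n → Eff k
    | .pure => .pure
    | .layer E C Nu Nb => .layer (E.subst σ) (C.subst (liftTSub σ)) Nu Nb
end

/-- `C[A/α]` for the type variable `α` with index `0`. -/
def CTy.inst {n : ℕ} (C : CTy (n + 1)) (A : VTy n) : CTy n :=
  C.subst (scons A VTy.var)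

/-- `C[α₁/α]` in the type environment extended by `α₁`, then by `α₂`. -/
def CTy.at1 {n : ℕ} (C : CTy (n + 1)) : CTy (n + 2) :=
  C.ren (scons 1 (fun a => a.succ.succ))

/-- `C[α₂/α]` in the type environment extended by `α₁`, then by `α₂`. -/
def CTy.at2 {n : ℕ} (C : CTy (n + 1)) : CTy (n + 2) :=
  C.ren (scons 0 (fun a => a.succ.succ))

/-- The effect `E` in the type environment extended by one type variable. -/
def Eff.wk1 {n : ℕ} (E : Eff n) : Eff (n + 1) := E.ren Fin.succ

/-- The effect `E` in the type environment extended by two type variables. -/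
def Eff.wk2 {n : ℕ} (E : Eff n) : Eff (n + 2) := E.ren (fun a => a.succ.succ)

/-- Value environments: `m` term variables, whose types are over `n` type variables. -/
abbrev Ctx (n m : ℕ) : Type := Fin m → VTy n

/-- The empty environment. -/
def Ctx.nil {n : ℕ} : Ctx n 0 := Fin.elim0

/-! ### Kinding and typing derivations

The side conditions of a judgement (well-kinded environment, type and effect) are premises of
those rules whose other premises do not already guarantee them. Derivations are data, because
the denotational semantics is defined on them. -/

mutual
  /-- Derivations of `Θ ⊢ E : Eff` -/
  inductive KEff : {n : ℕ} → Eff n → Type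
    | pure {n : ℕ} : KEff (Eff.pure (n := n))
    | layer {n : ℕ} {E : Eff n} {C : CTy (n + 1)} {Nu : Comp 1} {Nb : Comp 2}
        (kE : KEff E)
        (kC : KComp E.wk1 C)
        (du : TComp (scons (.var 0) Ctx.nil) E.wk1 Nu C)
        (db : TComp (scons (.U E.wk2 C.at1)
          (scons (.U E.wk2 (.arr (.var 1) C.at2)) Ctx.nil)) E.wk2 Nb C.at2) :
        KEff (.layer E C Nu Nb)
  /-- Derivations of `Θ ⊢ A : Val` -/
  inductive KVal : {n : ℕ} → VTy n → Type
    | var {n : ℕ} (a : Fin n) : KVal (.var a)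
    | unit {n : ℕ} : KVal (VTy.unit (n := n))
    | prod {n : ℕ} {A B : VTy n} (kA : KVal A) (kB : KVal B) : KVal (.prod A B)
    | variant {n : ℕ} {L : Finset ℕ} {A : L → VTy n} (kA : ∀ l, KVal (A l)) :
        KVal (.variant L A)
    | U {n : ℕ} {E : Eff n} {C : CTy n} (kC : KComp E C) : KVal (.U E C)
  /-- Derivations of `Θ ⊢ C : Comp_E` -/
  inductive KComp : {n : ℕ} → Eff n → CTy n → Type
    | F {n : ℕ} {E : Eff n} {A : VTy n} (kE : KEff E) (kA : KVal A) : KComp E (.F A)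
    | arr {n : ℕ} {E : Eff n} {A : VTy n} {C : CTy n} (kA : KVal A) (kC : KComp E C) :
        KComp E (.arr A C)
    | prod {n : ℕ} {E : Eff n} {C D : CTy n} (kC : KComp E C) (kD : KComp E D) :
        KComp E (.prod C D)
  /-- Derivations of `Θ; Γ ⊢ V : A` -/
  inductive TVal : {n m : ℕ} → Ctx n m → Val m → VTy n → Type
    | var {n m : ℕ} {Γ : Ctx n m} (kΓ : ∀ i, KVal (Γ i)) (i : Fin m) :
        TVal Γ (.var i) (Γ i)
    | unit {n m : ℕ} {Γ : Ctx n m} (kΓ : ∀ i, KVal (Γ i)) : TVal Γ .unit .unit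
    | pair {n m : ℕ} {Γ : Ctx n m} {V W : Val m} {A B : VTy n}
        (dV : TVal Γ V A) (dW : TVal Γ W B) : TVal Γ (.pair V W) (.prod A B)
    | inj {n m : ℕ} {Γ : Ctx n m} {V : Val m} {L : Finset ℕ} {A : L → VTy n}
        (kA : KVal (.variant L A)) (l : L) (dV : TVal Γ V (A l)) :
        TVal Γ (.inj l V) (.variant L A)
    | thunk {n m : ℕ} {Γ : Ctx n m} {E : Eff n} {M : Comp m} {C : CTy n}
        (dM : TComp Γ E M C) : TVal Γ (.thunk M) (.U E C)
  /-- Derivations of `Θ; Γ ⊢_E M : C` -/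
  inductive TComp : {n m : ℕ} → Ctx n m → Eff n → Comp m → CTy n → Type
    | split {n m : ℕ} {Γ : Ctx n m} {E : Eff n} {V : Val m} {M : Comp (m + 2)}
        {A B : VTy n} {C : CTy n}
        (dV : TVal Γ V (.prod A B)) (dM : TComp (scons A (scons B Γ)) E M C) :
        TComp Γ E (.split V M) C
    | case {n m : ℕ} {Γ : Ctx n m} {E : Eff n} {V : Val m} {L : Finset ℕ}
        {M : L → Comp (m + 1)} {A : L → VTy n} {C : CTy n}
        (kC : KComp E C)
        (dV : TVal Γ V (.variant L A)) (dM : ∀ l, TComp (scons (A l) Γ) E (M l) C) :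
        TComp Γ E (.case V L M) C
    | force {n m : ℕ} {Γ : Ctx n m} {E : Eff n} {V : Val m} {C : CTy n}
        (dV : TVal Γ V (.U E C)) : TComp Γ E (.force V) C
    | ret {n m : ℕ} {Γ : Ctx n m} {E : Eff n} {V : Val m} {A : VTy n}
        (kE : KEff E) (dV : TVal Γ V A) : TComp Γ E (.ret V) (.F A)
    | bind {n m : ℕ} {Γ : Ctx n m} {E : Eff n} {M : Comp m} {N : Comp (m + 1)}
        {A : VTy n} {C : CTy n} (kE : KEff E)
        (dM : TComp Γ E M (.F A)) (dN : TComp (scons A Γ) E N C) : TComp Γ E (.bind M N) C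
    | lam {n m : ℕ} {Γ : Ctx n m} {E : Eff n} {M : Comp (m + 1)} {A : VTy n} {C : CTy n}
        (dM : TComp (scons A Γ) E M C) : TComp Γ E (.lam M) (.arr A C)
    | app {n m : ℕ} {Γ : Ctx n m} {E : Eff n} {M : Comp m} {V : Val m} {A : VTy n}
        {C : CTy n} (dM : TComp Γ E M (.arr A C)) (dV : TVal Γ V A) : TComp Γ E (.app M V) C
    | cpair {n m : ℕ} {Γ : Ctx n m} {E : Eff n} {M N : Comp m} {C D : CTy n}
        (dM : TComp Γ E M C) (dN : TComp Γ E N D) : TComp Γ E (.cpair M N) (.prod C D)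
    | fst {n m : ℕ} {Γ : Ctx n m} {E : Eff n} {M : Comp m} {C D : CTy n}
        (dM : TComp Γ E M (.prod C D)) : TComp Γ E (.fst M) C
    | snd {n m : ℕ} {Γ : Ctx n m} {E : Eff n} {M : Comp m} {C D : CTy n}
        (dM : TComp Γ E M (.prod C D)) : TComp Γ E (.snd M) D
    | reflect {n m : ℕ} {Γ : Ctx n m} {E : Eff n} {C : CTy (n + 1)} {Nu : Comp 1}
        {Nb : Comp 2} {N : Comp m} {A : VTy n}
        (kT : KEff (.layer E C Nu Nb)) (kA : KVal A) (dN : TComp Γ E N (C.inst A)) :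
        TComp Γ (.layer E C Nu Nb) (.reflect N) (.F A)
    | reify {n m : ℕ} {Γ : Ctx n m} {E : Eff n} {C : CTy (n + 1)} {Nu : Comp 1}
        {Nb : Comp 2} {N : Comp m} {A : VTy n}
        (kT : KEff (.layer E C Nu Nb)) (dN : TComp Γ (.layer E C Nu Nb) N (.F A)) :
        TComp Γ E (.reify Nu Nb N) (C.inst A)
end

/-! ### Set-theoretic denotational semantics of types

The sets denoted by types do not depend on the unit and bind of the monads involved. -/

mutual
  /-- The set denoted by a value type under the type variable assignment `θ`. -/
  def VTy.den {n : ℕ} (θ : Fin n → Type) : VTy n → Type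
    | .var a => θ a
    | .unit => Unit
    | .prod A B => A.den θ × B.den θ
    | .variant _ A => Σ l, (A l).den θ
    | .U E C => C.den θ (E.den θ)
  /-- The carrier of the algebra denoted by a computation type, for an effect whose monad has
  the action `T` on sets. -/
  def CTy.den {n : ℕ} (θ : Fin n → Type) : CTy n → (Type → Type) → Type
    | .F A, T => T (A.den θ)
    | .arr A C, T => A.den θ → C.den θ T
    | .prod C D, T => C.den θ T × D.den θ T
  /-- The action on sets of the monad denoted by an effect. -/
  def Eff.den {n : ℕ} (θ : Fin n → Type) : Eff n → Type → Type
    | .pure, X => X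
    | .layer E C _ _, X => C.den (scons X θ) (E.den θ)
end

theorem den_liftRen {n k : ℕ} (ρ : Fin n → Fin k) (θ : Fin k → Type) (X : Type) :
    (fun a => scons X θ (liftRen ρ a)) = scons X (fun a => θ (ρ a)) := by
  funext a
  refine Fin.cases rfl (fun _ => rfl) a

mutual
  theorem VTy.den_ren {n k : ℕ} (ρ : Fin n → Fin k) (θ : Fin k → Type) :
      (A : VTy n) → (A.ren ρ).den θ = A.den (fun a => θ (ρ a))
    | .var a => by simp only [VTy.ren, VTy.den]
    | .unit => by simp only [VTy.ren, VTy.den]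
    | .prod A B => by
        simp only [VTy.ren, VTy.den]
        rw [VTy.den_ren ρ θ A, VTy.den_ren ρ θ B]
    | .variant L A => by
        simp only [VTy.ren, VTy.den]
        have h : ∀ l, ((A l).ren ρ).den θ = (A l).den (fun a => θ (ρ a)) :=
          fun l => VTy.den_ren ρ θ (A l)
        simp only [h]
    | .U E C => by
        simp only [VTy.ren, VTy.den]
        rw [CTy.den_ren ρ θ C, Eff.den_ren ρ θ E]
  theorem CTy.den_ren {n k : ℕ} (ρ : Fin n → Fin k) (θ : Fin k → Type) :
      (C : CTy n) → (C.ren ρ).den θ = C.den (fun a => θ (ρ a))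
    | .F A => by
        funext T
        simp only [CTy.ren, CTy.den]
        rw [VTy.den_ren ρ θ A]
    | .arr A C => by
        funext T
        simp only [CTy.ren, CTy.den]
        rw [VTy.den_ren ρ θ A, CTy.den_ren ρ θ C]
    | .prod C D => by
        funext T
        simp only [CTy.ren, CTy.den]
        rw [CTy.den_ren ρ θ C, CTy.den_ren ρ θ D]
  theorem Eff.den_ren {n k : ℕ} (ρ : Fin n → Fin k) (θ : Fin k → Type) :
      (E : Eff n) → (E.ren ρ).den θ = E.den (fun a => θ (ρ a))
    | .pure => by
        funext X
        simp only [Eff.ren, Eff.den]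
    | .layer E C Nu Nb => by
        funext X
        simp only [Eff.ren, Eff.den]
        rw [CTy.den_ren (liftRen ρ) (scons X θ) C, Eff.den_ren ρ θ E, den_liftRen]
end

theorem den_liftTSub {n k : ℕ} (σ : Fin n → VTy k) (θ : Fin k → Type) (X : Type) :
    (fun a => (liftTSub σ a).den (scons X θ)) = scons X (fun a => (σ a).den θ) := by
  funext a
  refine Fin.cases ?_ (fun a => ?_) a
  · simp [liftTSub, scons, VTy.den]
  · simp only [liftTSub, scons, Fin.cases_succ]
    rw [VTy.den_ren]
    rfl

mutual
  theorem VTy.den_subst {n k : ℕ} (σ : Fin n → VTy k) (θ : Fin k → Type) :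
      (A : VTy n) → (A.subst σ).den θ = A.den (fun a => (σ a).den θ)
    | .var a => by simp only [VTy.subst, VTy.den]
    | .unit => by simp only [VTy.subst, VTy.den]
    | .prod A B => by
        simp only [VTy.subst, VTy.den]
        rw [VTy.den_subst σ θ A, VTy.den_subst σ θ B]
    | .variant L A => by
        simp only [VTy.subst, VTy.den]
        have h : ∀ l, ((A l).subst σ).den θ = (A l).den (fun a => (σ a).den θ) :=
          fun l => VTy.den_subst σ θ (A l)
        simp only [h]
    | .U E C => by
        simp only [VTy.subst, VTy.den]
        rw [CTy.den_subst σ θ C, Eff.den_subst σ θ E]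
  theorem CTy.den_subst {n k : ℕ} (σ : Fin n → VTy k) (θ : Fin k → Type) :
      (C : CTy n) → (C.subst σ).den θ = C.den (fun a => (σ a).den θ)
    | .F A => by
        funext T
        simp only [CTy.subst, CTy.den]
        rw [VTy.den_subst σ θ A]
    | .arr A C => by
        funext T
        simp only [CTy.subst, CTy.den]
        rw [VTy.den_subst σ θ A, CTy.den_subst σ θ C]
    | .prod C D => by
        funext T
        simp only [CTy.subst, CTy.den]
        rw [CTy.den_subst σ θ C, CTy.den_subst σ θ D]
  theorem Eff.den_subst {n k : ℕ} (σ : Fin n → VTy k) (θ : Fin k → Type) :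
      (E : Eff n) → (E.subst σ).den θ = E.den (fun a => (σ a).den θ)
    | .pure => by
        funext X
        simp only [Eff.subst, Eff.den]
    | .layer E C Nu Nb => by
        funext X
        simp only [Eff.subst, Eff.den]
        rw [CTy.den_subst (liftTSub σ) (scons X θ) C, Eff.den_subst σ θ E, den_liftTSub]
end

theorem Eff.den_wk1 {n : ℕ} (E : Eff n) (θ : Fin n → Type) (X : Type) :
    E.wk1.den (scons X θ) = E.den θ :=
  Eff.den_ren Fin.succ (scons X θ) E

theorem Eff.den_wk2 {n : ℕ} (E : Eff n) (θ : Fin n → Type) (X Y : Type) :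
    E.wk2.den (scons Y (scons X θ)) = E.den θ :=
  Eff.den_ren (fun a => a.succ.succ) (scons Y (scons X θ)) E

theorem CTy.den_at1 {n : ℕ} (C : CTy (n + 1)) (θ : Fin n → Type) (X Y : Type) :
    C.at1.den (scons Y (scons X θ)) = C.den (scons X θ) := by
  refine (CTy.den_ren _ _ C).trans (congrArg (fun t => CTy.den t C) ?_)
  funext a
  refine Fin.cases rfl (fun _ => rfl) a

theorem CTy.den_at2 {n : ℕ} (C : CTy (n + 1)) (θ : Fin n → Type) (X Y : Type) :
    C.at2.den (scons Y (scons X θ)) = C.den (scons Y θ) := by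
  refine (CTy.den_ren _ _ C).trans (congrArg (fun t => CTy.den t C) ?_)
  funext a
  refine Fin.cases rfl (fun _ => rfl) a

theorem CTy.den_inst {n : ℕ} (C : CTy (n + 1)) (A : VTy n) (θ : Fin n → Type) :
    (C.inst A).den θ = C.den (scons (A.den θ) θ) := by
  refine (CTy.den_subst _ _ C).trans (congrArg (fun t => CTy.den t C) ?_)
  funext a
  refine Fin.cases rfl (fun b => ?_) a
  simp [scons, VTy.den]

/-! ### Monads and algebras -/

/-- The data of a monad on sets with the action `T`: unit and Kleisli extension. -/
structure MonadData (T : Type → Type) : Type 1 where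
  ret : {X : Type} → X → T X
  bind : {X Y : Type} → (X → T Y) → T X → T Y

/-- The data forms a set-theoretic monad. -/
structure MonadData.IsMonad {T : Type → Type} (μ : MonadData T) : Prop where
  ret_bind : ∀ {X Y : Type} (f : X → T Y) (x : X), μ.bind f (μ.ret x) = f x
  bind_ret : ∀ {X : Type} (t : T X), μ.bind μ.ret t = t
  bind_assoc : ∀ {X Y Z : Type} (f : X → T Y) (g : Y → T Z) (t : T X),
    μ.bind g (μ.bind f t) = μ.bind (fun x => μ.bind g (f x)) t

/-- The functorial action. -/
def MonadData.map {T : Type → Type} (μ : MonadData T) {X Y : Type} (f : X → Y) : T X → T Y :=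
  μ.bind (fun x => μ.ret (f x))

/-- The algebra structure of the algebra denoted by a computation type. -/
def CTy.alg {n : ℕ} (θ : Fin n → Type) {T : Type → Type} (μ : MonadData T) :
    (C : CTy n) → T (C.den θ T) → C.den θ T
  | .F _ => fun t => μ.bind id t
  | .arr _ C => fun t a => C.alg θ μ (μ.map (fun f => f a) t)
  | .prod C D => fun t => (C.alg θ μ (μ.map Prod.fst t), D.alg θ μ (μ.map Prod.snd t))

/-! ### Denotational semantics of derivations

The partial semantics is given by the total functions `KEff.denRet`, `KEff.denBind`,
`TVal.den` and `TComp.den`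
together with the domains of definition `KEff.Defined`, ..., `TComp.Defined`. -/

/-- The set denoted by an environment. -/
def Ctx.den {n m : ℕ} (Γ : Ctx n m) (θ : Fin n → Type) : Type := (i : Fin m) → (Γ i).den θ

def Ctx.dnil {n : ℕ} {θ : Fin n → Type} : (Ctx.nil (n := n)).den θ := fun i => i.elim0

def Ctx.dcons {n m : ℕ} {Γ : Ctx n m} {θ : Fin n → Type} {A : VTy n}
    (a : A.den θ) (γ : Γ.den θ) : Ctx.den (scons A Γ) θ :=
  fun i => Fin.cases (motive := fun i => (scons A Γ i).den θ) a γ i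

mutual
  /-- The unit of the monad denoted by an effect. For a layer over `E`, with
  `T X = ⟦C⟧(θ[α ↦ X])`, it is `⟦Nu⟧(θ[α ↦ X])(x)`. -/
  def KEff.denRet : {n : ℕ} → {E : Eff n} → KEff E → (θ : Fin n → Type) →
      (X : Type) → X → E.den θ X
    | _, _, .pure, _, _, x => x
    | _, _, .layer _ _ du _, θ, X, x =>
        cast (by simp only [Eff.den, Eff.den_wk1])
          (du.den (scons X θ) (Ctx.dcons (A := .var 0) x Ctx.dnil))
  /-- The Kleisli extension of the monad denoted by an effect. For a layer over `E`, with
  `T X = ⟦C⟧(θ[α ↦ X])`, it is `⟦Nb⟧(θ[α₁ ↦ X, α₂ ↦ Y])(t, f)`. -/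
  def KEff.denBind : {n : ℕ} → {E : Eff n} → KEff E → (θ : Fin n → Type) →
      (X Y : Type) → (X → E.den θ Y) → E.den θ X → E.den θ Y
    | _, _, .pure, _, _, _, f, t => f t
    | _, _, .layer (E := E) (C := C) _ _ _ db, θ, X, Y, f, t =>
        cast (by simp only [Eff.den, Eff.den_wk2, CTy.den_at2])
          (db.den (scons Y (scons X θ))
            (Ctx.dcons (A := .U E.wk2 C.at1)
              (cast (by simp only [Eff.den, VTy.den, Eff.den_wk2, CTy.den_at1]) t)
              (Ctx.dcons (A := .U E.wk2 (.arr (.var 1) C.at2))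
                (cast (by
                  simp only [Eff.den, VTy.den, CTy.den, Eff.den_wk2, CTy.den_at2]
                  rfl) f)
                Ctx.dnil)))
  def TVal.den : {n m : ℕ} → {Γ : Ctx n m} → {V : Val m} → {A : VTy n} → TVal Γ V A →
      (θ : Fin n → Type) → Γ.den θ → A.den θ
    | _, _, Γ, _, .(Γ i), .var _ i, _, γ => γ i
    | _, _, _, _, _, .unit _, _, _ => ()
    | _, _, _, _, _, .pair dV dW, θ, γ => (dV.den θ γ, dW.den θ γ)
    | _, _, _, _, _, .inj _ l dV, θ, γ => ⟨l, dV.den θ γ⟩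
    | _, _, _, _, _, .thunk dM, θ, γ => dM.den θ γ
  def TComp.den : {n m : ℕ} → {Γ : Ctx n m} → {E : Eff n} → {M : Comp m} → {C : CTy n} →
      TComp Γ E M C → (θ : Fin n → Type) → Γ.den θ → C.den θ (E.den θ)
    | _, _, _, _, _, _, .split dV dM, θ, γ =>
        dM.den θ (Ctx.dcons (dV.den θ γ).1 (Ctx.dcons (dV.den θ γ).2 γ))
    | _, _, _, _, _, _, .case _ dV dM, θ, γ =>
        (dM (dV.den θ γ).1).den θ (Ctx.dcons (dV.den θ γ).2 γ)
    | _, _, _, _, _, _, .force dV, θ, γ => dV.den θ γ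
    | _, _, _, _, _, _, .ret kE dV, θ, γ => kE.denRet θ _ (dV.den θ γ)
    | _, _, _, E, _, C, .bind kE dM dN, θ, γ =>
        let μ : MonadData (Eff.den θ E) := ⟨kE.denRet θ _, kE.denBind θ _ _⟩
        C.alg θ μ
          (μ.map (fun a => dN.den θ (Ctx.dcons a γ)) (dM.den θ γ))
    | _, _, _, _, _, _, .lam dM, θ, γ => fun a => dM.den θ (Ctx.dcons a γ)
    | _, _, _, _, _, _, .app dM dV, θ, γ => (dM.den θ γ) (dV.den θ γ)
    | _, _, _, _, _, _, .cpair dM dN, θ, γ => (dM.den θ γ, dN.den θ γ)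
    | _, _, _, _, _, _, .fst dM, θ, γ => (dM.den θ γ).1
    | _, _, _, _, _, _, .snd dM, θ, γ => (dM.den θ γ).2
    | _, _, _, _, _, _, .reflect _ _ dN, θ, γ =>
        cast (by simp only [CTy.den, Eff.den, CTy.den_inst]) (dN.den θ γ)
    | _, _, _, _, _, _, .reify _ dN, θ, γ =>
        cast (by simp only [CTy.den, Eff.den, CTy.den_inst]) (dN.den θ γ)
end

/-- The unit and Kleisli extension denoted by an effect. -/
def KEff.den {n : ℕ} {E : Eff n} (kE : KEff E) (θ : Fin n → Type) : MonadData (E.den θ) :=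
  ⟨kE.denRet θ _, kE.denBind θ _ _⟩

mutual
  /-- The semantics of the derivation is defined at `θ`: so is that of the sub-derivations, and
  the data denoted by a monad does form a monad. -/
  def KEff.Defined : {n : ℕ} → {E : Eff n} → KEff E → (Fin n → Type) → Prop
    | _, _, .pure, _ => True
    | _, _, .layer kE kC du db, θ =>
        kE.Defined θ ∧ (∀ X : Type, kC.Defined (scons X θ)) ∧
        (∀ X : Type, du.Defined (scons X θ)) ∧
        (∀ X Y : Type, db.Defined (scons Y (scons X θ))) ∧
        ((KEff.layer kE kC du db).den θ).IsMonad
  def KVal.Defined : {n : ℕ} → {A : VTy n} → KVal A → (Fin n → Type) → Prop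
    | _, _, .var _, _ => True
    | _, _, .unit, _ => True
    | _, _, .prod kA kB, θ => kA.Defined θ ∧ kB.Defined θ
    | _, _, .variant kA, θ => ∀ l, (kA l).Defined θ
    | _, _, .U kC, θ => kC.Defined θ
  def KComp.Defined : {n : ℕ} → {E : Eff n} → {C : CTy n} → KComp E C →
      (Fin n → Type) → Prop
    | _, _, _, .F kE kA, θ => kE.Defined θ ∧ kA.Defined θ
    | _, _, _, .arr kA kC, θ => kA.Defined θ ∧ kC.Defined θ
    | _, _, _, .prod kC kD, θ => kC.Defined θ ∧ kD.Defined θ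
  def TVal.Defined : {n m : ℕ} → {Γ : Ctx n m} → {V : Val m} → {A : VTy n} → TVal Γ V A →
      (Fin n → Type) → Prop
    | _, _, Γ, _, .(Γ i), .var kΓ i, θ => ∀ j, (kΓ j).Defined θ
    | _, _, _, _, _, .unit kΓ, θ => ∀ j, (kΓ j).Defined θ
    | _, _, _, _, _, .pair dV dW, θ => dV.Defined θ ∧ dW.Defined θ
    | _, _, _, _, _, .inj kA _ dV, θ => kA.Defined θ ∧ dV.Defined θ
    | _, _, _, _, _, .thunk dM, θ => dM.Defined θ
  def TComp.Defined : {n m : ℕ} → {Γ : Ctx n m} → {E : Eff n} → {M : Comp m} → {C : CTy n} →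
      TComp Γ E M C → (Fin n → Type) → Prop
    | _, _, _, _, _, _, .split dV dM, θ => dV.Defined θ ∧ dM.Defined θ
    | _, _, _, _, _, _, .case kC dV dM, θ =>
        kC.Defined θ ∧ dV.Defined θ ∧ ∀ l, (dM l).Defined θ
    | _, _, _, _, _, _, .force dV, θ => dV.Defined θ
    | _, _, _, _, _, _, .ret kE dV, θ => kE.Defined θ ∧ dV.Defined θ
    | _, _, _, _, _, _, .bind kE dM dN, θ => kE.Defined θ ∧ dM.Defined θ ∧ dN.Defined θ
    | _, _, _, _, _, _, .lam dM, θ => dM.Defined θ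
    | _, _, _, _, _, _, .app dM dV, θ => dM.Defined θ ∧ dV.Defined θ
    | _, _, _, _, _, _, .cpair dM dN, θ => dM.Defined θ ∧ dN.Defined θ
    | _, _, _, _, _, _, .fst dM, θ => dM.Defined θ
    | _, _, _, _, _, _, .snd dM, θ => dM.Defined θ
    | _, _, _, _, _, _, .reflect kT kA dN, θ =>
        kT.Defined θ ∧ kA.Defined θ ∧ dN.Defined θ
    | _, _, _, _, _, _, .reify kT dN, θ => kT.Defined θ ∧ dN.Defined θ
end

/-- A proper derivation: its semantics is defined for all type variable assignments. -/
def TComp.Proper {n m : ℕ} {Γ : Ctx n m} {E : Eff n} {M : Comp m} {C : CTy n}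
    (d : TComp Γ E M C) : Prop :=
  ∀ θ : Fin n → Type, d.Defined θ

/-- `Θ; Γ ⊢ V : A` is derivable. -/
def HasVType {n m : ℕ} (Γ : Ctx n m) (V : Val m) (A : VTy n) : Prop :=
  Nonempty (TVal Γ V A)

/-- `Θ; Γ ⊢_E M : C` has a proper derivation. -/
def HasProperCType {n m : ℕ} (Γ : Ctx n m) (E : Eff n) (M : Comp m) (C : CTy n) : Prop :=
  ∃ d : TComp Γ E M C, d.Proper

end LamMon

namespace LamMon

-- Termination is proved by Tait's method of reducibility predicates, with determinism and subject
-- reduction supplying the rest.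
--
-- Each value type is interpreted by a set of closed values and each computation type by a set of
-- closed computations, with type variables ranging over arbitrary sets of closed values. At the
-- effect $\emptyset$ a returner is reducible if it evaluates to a returned reducible value. At a
-- layer $E\prec(\alpha.C)\,T$ it is reducible if it generates a well-founded tree (`Reflecting`): a
-- leaf is a computation evaluating to a returned value of the right kind; a node is one evaluating
-- to $H[\mathbf{reflect}\,N]$, where for some set $Y$ the computation $N$ is reducible at $C$ with
-- $\alpha\mapsto Y$, and there is a subtree $H[\mathbf{return}\,V]$ for every $V\in Y$. Since $Y$
-- ranges over all sets of closed values rather than over types, the definition is by recursion on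
-- the syntax of types and effects.
--
-- Two inductions over these trees carry the argument. `Eff.red_plug` grafts trees, which makes
-- $\mathbf{let}$ reducible and extends to all computation types through `CTy.red_plug`.
-- `Reflecting.reify` folds a tree with the unit and the Kleisli extension of the monad; the
-- recursive calls of the fold are exactly the continuations built by the reduction rule for
-- $\mathbf{reflect}$. The bodies of the monad are typed over type variables, so they preserve
-- reducibility at every choice of sets, in particular at the unknown $Y$ of a node. The fundamental
-- theorem `TComp.subst_mem_red` follows by recursion on derivations, and a closed returner at
-- $\emptyset$ therefore evaluates to some $\mathbf{return}\,V$.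
--
-- Reduction is contained in the graph of a function (`Comp.next`), so one terminating reduction
-- sequence excludes divergence and gives uniqueness of $V$. Reducibility says nothing about typing,
-- so the type of $V$ comes from subject reduction.

@[simp] theorem scons_zero {X : Type*} {n : ℕ} (a : X) (f : Fin n → X) : scons a f 0 = a := rfl

@[simp] theorem scons_succ {X : Type*} {n : ℕ} (a : X) (f : Fin n → X) (i : Fin n) :
    scons a f i.succ = f i := rfl

@[simp] theorem scons_one {X : Type*} {n : ℕ} (a : X) (f : Fin (n + 1) → X) :
    scons a f 1 = f 0 := rfl

theorem scons_comp {X Y : Type*} {n : ℕ} (g : X → Y) (a : X) (f : Fin n → X) :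
    (fun i => g (scons a f i)) = scons (g a) (fun i => g (f i)) := by
  funext i
  exact Fin.cases rfl (fun _ => rfl) i

theorem scons_liftRen {X : Type*} {m k : ℕ} (ρ : Fin m → Fin k) (a : X) (f : Fin k → X) :
    (fun i => scons a f (liftRen ρ i)) = scons a (fun i => f (ρ i)) := by
  funext i
  exact Fin.cases rfl (fun _ => rfl) i

theorem liftRen_liftRen {m k l : ℕ} (ρ : Fin m → Fin k) (τ : Fin k → Fin l) :
    (fun i => liftRen τ (liftRen ρ i)) = liftRen (fun i => τ (ρ i)) :=
  scons_liftRen ρ _ _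

/-! ### Renaming and substitution in terms -/

theorem liftSub_liftRen {m k l : ℕ} (ρ : Fin m → Fin k) (σ : Fin k → Val l) :
    (fun i => liftSub σ (liftRen ρ i)) = liftSub (fun i => σ (ρ i)) :=
  scons_liftRen ρ _ _

mutual
  -- The four composition laws have to be proved in a suitable order: lifting a substitution renames
  -- its values, so renaming after substitution rests on `Val.ren_ren`, and substitution after
  -- substitution rests on both mixed laws.
  theorem Val.ren_ren {m k l : ℕ} (ρ : Fin m → Fin k) (τ : Fin k → Fin l) :
      (V : Val m) → (V.ren ρ).ren τ = V.ren (fun i => τ (ρ i))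
    | .var i => by simp only [Val.ren]
    | .unit => by simp only [Val.ren]
    | .pair V W => by simp only [Val.ren, Val.ren_ren ρ τ V, Val.ren_ren ρ τ W]
    | .inj l V => by simp only [Val.ren, Val.ren_ren ρ τ V]
    | .thunk M => by simp only [Val.ren, Comp.ren_ren ρ τ M]
  theorem Comp.ren_ren {m k l : ℕ} (ρ : Fin m → Fin k) (τ : Fin k → Fin l) :
      (M : Comp m) → (M.ren ρ).ren τ = M.ren (fun i => τ (ρ i))
    | .split V M => by
        simp only [Comp.ren, Val.ren_ren ρ τ V,
          Comp.ren_ren (liftRen (liftRen ρ)) (liftRen (liftRen τ)) M, liftRen_liftRen]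
    | .case V L M => by
        simp only [Comp.ren, Val.ren_ren ρ τ V,
          fun l => Comp.ren_ren (liftRen ρ) (liftRen τ) (M l), liftRen_liftRen]
    | .force V => by simp only [Comp.ren, Val.ren_ren ρ τ V]
    | .ret V => by simp only [Comp.ren, Val.ren_ren ρ τ V]
    | .bind M N => by
        simp only [Comp.ren, Comp.ren_ren ρ τ M,
          Comp.ren_ren (liftRen ρ) (liftRen τ) N, liftRen_liftRen]
    | .lam M => by
        simp only [Comp.ren, Comp.ren_ren (liftRen ρ) (liftRen τ) M, liftRen_liftRen]
    | .app M V => by simp only [Comp.ren, Comp.ren_ren ρ τ M, Val.ren_ren ρ τ V]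
    | .cpair M N => by simp only [Comp.ren, Comp.ren_ren ρ τ M, Comp.ren_ren ρ τ N]
    | .fst M => by simp only [Comp.ren, Comp.ren_ren ρ τ M]
    | .snd M => by simp only [Comp.ren, Comp.ren_ren ρ τ M]
    | .reflect N => by simp only [Comp.ren, Comp.ren_ren ρ τ N]
    | .reify Nu Nb N => by simp only [Comp.ren, Comp.ren_ren ρ τ N]
end

mutual
  theorem Val.subst_ren {m k l : ℕ} (ρ : Fin m → Fin k) (σ : Fin k → Val l) :
      (V : Val m) → (V.ren ρ).subst σ = V.subst (fun i => σ (ρ i))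
    | .var i => by simp only [Val.ren, Val.subst]
    | .unit => by simp only [Val.ren, Val.subst]
    | .pair V W => by
        simp only [Val.ren, Val.subst, Val.subst_ren ρ σ V, Val.subst_ren ρ σ W]
    | .inj l V => by simp only [Val.ren, Val.subst, Val.subst_ren ρ σ V]
    | .thunk M => by simp only [Val.ren, Val.subst, Comp.subst_ren ρ σ M]
  theorem Comp.subst_ren {m k l : ℕ} (ρ : Fin m → Fin k) (σ : Fin k → Val l) :
      (M : Comp m) → (M.ren ρ).subst σ = M.subst (fun i => σ (ρ i))
    | .split V M => by
        simp only [Comp.ren, Comp.subst, Val.subst_ren ρ σ V,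
          Comp.subst_ren (liftRen (liftRen ρ)) (liftSub (liftSub σ)) M, liftSub_liftRen]
    | .case V L M => by
        simp only [Comp.ren, Comp.subst, Val.subst_ren ρ σ V,
          fun l => Comp.subst_ren (liftRen ρ) (liftSub σ) (M l), liftSub_liftRen]
    | .force V => by simp only [Comp.ren, Comp.subst, Val.subst_ren ρ σ V]
    | .ret V => by simp only [Comp.ren, Comp.subst, Val.subst_ren ρ σ V]
    | .bind M N => by
        simp only [Comp.ren, Comp.subst, Comp.subst_ren ρ σ M,
          Comp.subst_ren (liftRen ρ) (liftSub σ) N, liftSub_liftRen]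
    | .lam M => by
        simp only [Comp.ren, Comp.subst, Comp.subst_ren (liftRen ρ) (liftSub σ) M,
          liftSub_liftRen]
    | .app M V => by
        simp only [Comp.ren, Comp.subst, Comp.subst_ren ρ σ M, Val.subst_ren ρ σ V]
    | .cpair M N => by
        simp only [Comp.ren, Comp.subst, Comp.subst_ren ρ σ M, Comp.subst_ren ρ σ N]
    | .fst M => by simp only [Comp.ren, Comp.subst, Comp.subst_ren ρ σ M]
    | .snd M => by simp only [Comp.ren, Comp.subst, Comp.subst_ren ρ σ M]
    | .reflect N => by simp only [Comp.ren, Comp.subst, Comp.subst_ren ρ σ N]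
    | .reify Nu Nb N => by simp only [Comp.ren, Comp.subst, Comp.subst_ren ρ σ N]
end

theorem ren_liftSub {m k l : ℕ} (σ : Fin m → Val k) (τ : Fin k → Fin l) :
    (fun i => (liftSub σ i).ren (liftRen τ)) = liftSub (fun i => (σ i).ren τ) := by
  funext i
  refine Fin.cases (by simp [liftSub, liftRen, Val.ren]) (fun i => ?_) i
  simp [liftSub, liftRen, Val.ren_ren]

mutual
  theorem Val.ren_subst {m k l : ℕ} (σ : Fin m → Val k) (τ : Fin k → Fin l) :
      (V : Val m) → (V.subst σ).ren τ = V.subst (fun i => (σ i).ren τ)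
    | .var i => by simp only [Val.subst]
    | .unit => by simp only [Val.ren, Val.subst]
    | .pair V W => by
        simp only [Val.ren, Val.subst, Val.ren_subst σ τ V, Val.ren_subst σ τ W]
    | .inj l V => by simp only [Val.ren, Val.subst, Val.ren_subst σ τ V]
    | .thunk M => by simp only [Val.ren, Val.subst, Comp.ren_subst σ τ M]
  theorem Comp.ren_subst {m k l : ℕ} (σ : Fin m → Val k) (τ : Fin k → Fin l) :
      (M : Comp m) → (M.subst σ).ren τ = M.subst (fun i => (σ i).ren τ)
    | .split V M => by
        simp only [Comp.ren, Comp.subst, Val.ren_subst σ τ V,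
          Comp.ren_subst (liftSub (liftSub σ)) (liftRen (liftRen τ)) M, ren_liftSub]
    | .case V L M => by
        simp only [Comp.ren, Comp.subst, Val.ren_subst σ τ V,
          fun l => Comp.ren_subst (liftSub σ) (liftRen τ) (M l), ren_liftSub]
    | .force V => by simp only [Comp.ren, Comp.subst, Val.ren_subst σ τ V]
    | .ret V => by simp only [Comp.ren, Comp.subst, Val.ren_subst σ τ V]
    | .bind M N => by
        simp only [Comp.ren, Comp.subst, Comp.ren_subst σ τ M,
          Comp.ren_subst (liftSub σ) (liftRen τ) N, ren_liftSub]
    | .lam M => by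
        simp only [Comp.ren, Comp.subst, Comp.ren_subst (liftSub σ) (liftRen τ) M, ren_liftSub]
    | .app M V => by
        simp only [Comp.ren, Comp.subst, Comp.ren_subst σ τ M, Val.ren_subst σ τ V]
    | .cpair M N => by
        simp only [Comp.ren, Comp.subst, Comp.ren_subst σ τ M, Comp.ren_subst σ τ N]
    | .fst M => by simp only [Comp.ren, Comp.subst, Comp.ren_subst σ τ M]
    | .snd M => by simp only [Comp.ren, Comp.subst, Comp.ren_subst σ τ M]
    | .reflect N => by simp only [Comp.ren, Comp.subst, Comp.ren_subst σ τ N]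
    | .reify Nu Nb N => by simp only [Comp.ren, Comp.subst, Comp.ren_subst σ τ N]
end

theorem subst_liftSub {m k l : ℕ} (σ : Fin m → Val k) (τ : Fin k → Val l) :
    (fun i => (liftSub σ i).subst (liftSub τ)) = liftSub (fun i => (σ i).subst τ) := by
  funext i
  refine Fin.cases (by simp [liftSub, Val.subst]) (fun i => ?_) i
  simp [liftSub, Val.subst_ren, Val.ren_subst]

mutual
  theorem Val.subst_subst {m k l : ℕ} (σ : Fin m → Val k) (τ : Fin k → Val l) :
      (V : Val m) → (V.subst σ).subst τ = V.subst (fun i => (σ i).subst τ)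
    | .var i => by simp only [Val.subst]
    | .unit => by simp only [Val.subst]
    | .pair V W => by simp only [Val.subst, Val.subst_subst σ τ V, Val.subst_subst σ τ W]
    | .inj l V => by simp only [Val.subst, Val.subst_subst σ τ V]
    | .thunk M => by simp only [Val.subst, Comp.subst_subst σ τ M]
  theorem Comp.subst_subst {m k l : ℕ} (σ : Fin m → Val k) (τ : Fin k → Val l) :
      (M : Comp m) → (M.subst σ).subst τ = M.subst (fun i => (σ i).subst τ)
    | .split V M => by
        simp only [Comp.subst, Val.subst_subst σ τ V,
          Comp.subst_subst (liftSub (liftSub σ)) (liftSub (liftSub τ)) M, subst_liftSub]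
    | .case V L M => by
        simp only [Comp.subst, Val.subst_subst σ τ V,
          fun l => Comp.subst_subst (liftSub σ) (liftSub τ) (M l), subst_liftSub]
    | .force V => by simp only [Comp.subst, Val.subst_subst σ τ V]
    | .ret V => by simp only [Comp.subst, Val.subst_subst σ τ V]
    | .bind M N => by
        simp only [Comp.subst, Comp.subst_subst σ τ M,
          Comp.subst_subst (liftSub σ) (liftSub τ) N, subst_liftSub]
    | .lam M => by
        simp only [Comp.subst, Comp.subst_subst (liftSub σ) (liftSub τ) M, subst_liftSub]
    | .app M V => by simp only [Comp.subst, Comp.subst_subst σ τ M, Val.subst_subst σ τ V]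
    | .cpair M N => by simp only [Comp.subst, Comp.subst_subst σ τ M, Comp.subst_subst σ τ N]
    | .fst M => by simp only [Comp.subst, Comp.subst_subst σ τ M]
    | .snd M => by simp only [Comp.subst, Comp.subst_subst σ τ M]
    | .reflect N => by simp only [Comp.subst, Comp.subst_subst σ τ N]
    | .reify Nu Nb N => by simp only [Comp.subst, Comp.subst_subst σ τ N]
end

theorem liftSub_var {m : ℕ} : liftSub (Val.var (m := m)) = Val.var := by
  funext i
  refine Fin.cases rfl (fun i => ?_) i
  simp [liftSub, Val.ren]

mutual
  theorem Val.subst_var {m : ℕ} : (V : Val m) → V.subst Val.var = V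
    | .var i => by simp only [Val.subst]
    | .unit => by simp only [Val.subst]
    | .pair V W => by simp only [Val.subst, Val.subst_var V, Val.subst_var W]
    | .inj l V => by simp only [Val.subst, Val.subst_var V]
    | .thunk M => by simp only [Val.subst, Comp.subst_var M]
  theorem Comp.subst_var {m : ℕ} : (M : Comp m) → M.subst Val.var = M
    | .split V M => by simp only [Comp.subst, liftSub_var, Val.subst_var V, Comp.subst_var M]
    | .case V L M => by
        simp only [Comp.subst, liftSub_var, Val.subst_var V, fun l => Comp.subst_var (M l)]
    | .force V => by simp only [Comp.subst, Val.subst_var V]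
    | .ret V => by simp only [Comp.subst, Val.subst_var V]
    | .bind M N => by simp only [Comp.subst, liftSub_var, Comp.subst_var M, Comp.subst_var N]
    | .lam M => by simp only [Comp.subst, liftSub_var, Comp.subst_var M]
    | .app M V => by simp only [Comp.subst, Comp.subst_var M, Val.subst_var V]
    | .cpair M N => by simp only [Comp.subst, Comp.subst_var M, Comp.subst_var N]
    | .fst M => by simp only [Comp.subst, Comp.subst_var M]
    | .snd M => by simp only [Comp.subst, Comp.subst_var M]
    | .reflect N => by simp only [Comp.subst, Comp.subst_var N]
    | .reify Nu Nb N => by simp only [Comp.subst, Comp.subst_var N]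
end

theorem subst_scons_liftSub {m k : ℕ} (σ : Fin m → Val k) (τ : Fin k → Val k) (W : Val k) :
    (fun i => (liftSub σ i).subst (scons W τ)) = scons W (fun i => (σ i).subst τ) := by
  funext i
  refine Fin.cases rfl (fun i => ?_) i
  simp [liftSub, Val.subst_ren]

/-- This identifies the $\beta$-reduct of a closed instance of a binder with the instance of its
body under the extended closing substitution, which is the form in which reducibility of the body is
available. -/
theorem Comp.subst_liftSub_subst1 {m k : ℕ} (M : Comp (m + 1)) (σ : Fin m → Val k)
    (V : Val k) : (M.subst (liftSub σ)).subst1 V = M.subst (scons V σ) := by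
  simp only [Comp.subst1, Comp.subst_subst, subst_scons_liftSub, Val.subst_var]

theorem Comp.subst_liftSub_liftSub_subst {m k : ℕ} (M : Comp (m + 2)) (σ : Fin m → Val k)
    (V W : Val k) :
    (M.subst (liftSub (liftSub σ))).subst (scons V (scons W Val.var)) =
      M.subst (scons V (scons W σ)) := by
  rw [Comp.subst_subst]
  congr 1
  funext i
  refine Fin.cases rfl (fun i => Fin.cases ?_ (fun i => ?_) i) i
  · simp [liftSub, Val.subst, Val.ren]
  · simp [liftSub, Val.subst_ren, Val.subst_var]

theorem Val.subst_scons_ren_succ {m : ℕ} (W V : Val m) :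
    (W.ren Fin.succ).subst (scons V Val.var) = W := by
  simp only [Val.subst_ren, scons_succ, Val.subst_var]

/-- The context was weakened only to be placed under the $\lambda$ of a captured continuation, so
the argument reaches nothing but the hole. Applying the continuation to $V$ thus restores $H$ itself
around $\mathbf{return}\,V$. -/
theorem HCtx.subst_plug_ren_succ {m : ℕ} (V : Val m) : (H : HCtx m) → (M : Comp (m + 1)) →
    ((H.ren Fin.succ).plug M).subst (scons V Val.var) = H.plug (M.subst (scons V Val.var))
  | .hole, M => rfl
  | .push H B, M => by
      simp only [HCtx.ren, HCtx.plug, HCtx.subst_plug_ren_succ V H]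
      congr 1
      cases B with
      | bind N =>
        simp only [BFrame.ren, BFrame.plug, Comp.subst, Comp.subst_ren, liftSub_liftRen,
          scons_succ, liftSub_var, Comp.subst_var]
      | app W => simp only [BFrame.ren, BFrame.plug, Comp.subst, Val.subst_scons_ren_succ]
      | fst => rfl
      | snd => rfl

/-! ### Renaming and substitution in types -/

theorem liftTSub_liftRen {m k l : ℕ} (ρ : Fin m → Fin k) (σ : Fin k → VTy l) :
    (fun i => liftTSub σ (liftRen ρ i)) = liftTSub (fun i => σ (ρ i)) :=
  scons_liftRen ρ _ _

mutual
  theorem VTy.ren_ren {m k l : ℕ} (ρ : Fin m → Fin k) (τ : Fin k → Fin l) :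
      (A : VTy m) → (A.ren ρ).ren τ = A.ren (fun i => τ (ρ i))
    | .var i => by simp only [VTy.ren]
    | .unit => by simp only [VTy.ren]
    | .prod A B => by simp only [VTy.ren, VTy.ren_ren ρ τ A, VTy.ren_ren ρ τ B]
    | .variant L A => by simp only [VTy.ren, fun l => VTy.ren_ren ρ τ (A l)]
    | .U E C => by simp only [VTy.ren, Eff.ren_ren ρ τ E, CTy.ren_ren ρ τ C]
  theorem CTy.ren_ren {m k l : ℕ} (ρ : Fin m → Fin k) (τ : Fin k → Fin l) :
      (C : CTy m) → (C.ren ρ).ren τ = C.ren (fun i => τ (ρ i))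
    | .F A => by simp only [CTy.ren, VTy.ren_ren ρ τ A]
    | .arr A C => by simp only [CTy.ren, VTy.ren_ren ρ τ A, CTy.ren_ren ρ τ C]
    | .prod C D => by simp only [CTy.ren, CTy.ren_ren ρ τ C, CTy.ren_ren ρ τ D]
  theorem Eff.ren_ren {m k l : ℕ} (ρ : Fin m → Fin k) (τ : Fin k → Fin l) :
      (E : Eff m) → (E.ren ρ).ren τ = E.ren (fun i => τ (ρ i))
    | .pure => by simp only [Eff.ren]
    | .layer E C Nu Nb => by
        simp only [Eff.ren, Eff.ren_ren ρ τ E, CTy.ren_ren (liftRen ρ) (liftRen τ) C,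
          liftRen_liftRen]
end

mutual
  theorem VTy.subst_ren {m k l : ℕ} (ρ : Fin m → Fin k) (σ : Fin k → VTy l) :
      (A : VTy m) → (A.ren ρ).subst σ = A.subst (fun i => σ (ρ i))
    | .var i => by simp only [VTy.ren, VTy.subst]
    | .unit => by simp only [VTy.ren, VTy.subst]
    | .prod A B => by
        simp only [VTy.ren, VTy.subst, VTy.subst_ren ρ σ A, VTy.subst_ren ρ σ B]
    | .variant L A => by simp only [VTy.ren, VTy.subst, fun l => VTy.subst_ren ρ σ (A l)]
    | .U E C => by simp only [VTy.ren, VTy.subst, Eff.subst_ren ρ σ E, CTy.subst_ren ρ σ C]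
  theorem CTy.subst_ren {m k l : ℕ} (ρ : Fin m → Fin k) (σ : Fin k → VTy l) :
      (C : CTy m) → (C.ren ρ).subst σ = C.subst (fun i => σ (ρ i))
    | .F A => by simp only [CTy.ren, CTy.subst, VTy.subst_ren ρ σ A]
    | .arr A C => by
        simp only [CTy.ren, CTy.subst, VTy.subst_ren ρ σ A, CTy.subst_ren ρ σ C]
    | .prod C D => by
        simp only [CTy.ren, CTy.subst, CTy.subst_ren ρ σ C, CTy.subst_ren ρ σ D]
  theorem Eff.subst_ren {m k l : ℕ} (ρ : Fin m → Fin k) (σ : Fin k → VTy l) :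
      (E : Eff m) → (E.ren ρ).subst σ = E.subst (fun i => σ (ρ i))
    | .pure => by simp only [Eff.ren, Eff.subst]
    | .layer E C Nu Nb => by
        simp only [Eff.ren, Eff.subst, Eff.subst_ren ρ σ E,
          CTy.subst_ren (liftRen ρ) (liftTSub σ) C, liftTSub_liftRen]
end

theorem ren_liftTSub {m k l : ℕ} (σ : Fin m → VTy k) (τ : Fin k → Fin l) :
    (fun i => (liftTSub σ i).ren (liftRen τ)) = liftTSub (fun i => (σ i).ren τ) := by
  funext i
  refine Fin.cases (by simp [liftTSub, liftRen, VTy.ren]) (fun i => ?_) i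
  simp [liftTSub, liftRen, VTy.ren_ren]

mutual
  theorem VTy.ren_subst {m k l : ℕ} (σ : Fin m → VTy k) (τ : Fin k → Fin l) :
      (A : VTy m) → (A.subst σ).ren τ = A.subst (fun i => (σ i).ren τ)
    | .var i => by simp only [VTy.subst]
    | .unit => by simp only [VTy.ren, VTy.subst]
    | .prod A B => by
        simp only [VTy.ren, VTy.subst, VTy.ren_subst σ τ A, VTy.ren_subst σ τ B]
    | .variant L A => by simp only [VTy.ren, VTy.subst, fun l => VTy.ren_subst σ τ (A l)]
    | .U E C => by simp only [VTy.ren, VTy.subst, Eff.ren_subst σ τ E, CTy.ren_subst σ τ C]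
  theorem CTy.ren_subst {m k l : ℕ} (σ : Fin m → VTy k) (τ : Fin k → Fin l) :
      (C : CTy m) → (C.subst σ).ren τ = C.subst (fun i => (σ i).ren τ)
    | .F A => by simp only [CTy.ren, CTy.subst, VTy.ren_subst σ τ A]
    | .arr A C => by
        simp only [CTy.ren, CTy.subst, VTy.ren_subst σ τ A, CTy.ren_subst σ τ C]
    | .prod C D => by
        simp only [CTy.ren, CTy.subst, CTy.ren_subst σ τ C, CTy.ren_subst σ τ D]
  theorem Eff.ren_subst {m k l : ℕ} (σ : Fin m → VTy k) (τ : Fin k → Fin l) :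
      (E : Eff m) → (E.subst σ).ren τ = E.subst (fun i => (σ i).ren τ)
    | .pure => by simp only [Eff.ren, Eff.subst]
    | .layer E C Nu Nb => by
        simp only [Eff.ren, Eff.subst, Eff.ren_subst σ τ E,
          CTy.ren_subst (liftTSub σ) (liftRen τ) C, ren_liftTSub]
end

theorem subst_liftTSub {m k l : ℕ} (σ : Fin m → VTy k) (τ : Fin k → VTy l) :
    (fun i => (liftTSub σ i).subst (liftTSub τ)) = liftTSub (fun i => (σ i).subst τ) := by
  funext i
  refine Fin.cases (by simp [liftTSub, VTy.subst]) (fun i => ?_) i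
  simp [liftTSub, VTy.subst_ren, VTy.ren_subst]

mutual
  theorem VTy.subst_subst {m k l : ℕ} (σ : Fin m → VTy k) (τ : Fin k → VTy l) :
      (A : VTy m) → (A.subst σ).subst τ = A.subst (fun i => (σ i).subst τ)
    | .var i => by simp only [VTy.subst]
    | .unit => by simp only [VTy.subst]
    | .prod A B => by simp only [VTy.subst, VTy.subst_subst σ τ A, VTy.subst_subst σ τ B]
    | .variant L A => by simp only [VTy.subst, fun l => VTy.subst_subst σ τ (A l)]
    | .U E C => by simp only [VTy.subst, Eff.subst_subst σ τ E, CTy.subst_subst σ τ C]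
  theorem CTy.subst_subst {m k l : ℕ} (σ : Fin m → VTy k) (τ : Fin k → VTy l) :
      (C : CTy m) → (C.subst σ).subst τ = C.subst (fun i => (σ i).subst τ)
    | .F A => by simp only [CTy.subst, VTy.subst_subst σ τ A]
    | .arr A C => by simp only [CTy.subst, VTy.subst_subst σ τ A, CTy.subst_subst σ τ C]
    | .prod C D => by simp only [CTy.subst, CTy.subst_subst σ τ C, CTy.subst_subst σ τ D]
  theorem Eff.subst_subst {m k l : ℕ} (σ : Fin m → VTy k) (τ : Fin k → VTy l) :
      (E : Eff m) → (E.subst σ).subst τ = E.subst (fun i => (σ i).subst τ)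
    | .pure => by simp only [Eff.subst]
    | .layer E C Nu Nb => by
        simp only [Eff.subst, Eff.subst_subst σ τ E,
          CTy.subst_subst (liftTSub σ) (liftTSub τ) C, subst_liftTSub]
end

theorem liftTSub_var {n : ℕ} : liftTSub (VTy.var (n := n)) = VTy.var := by
  funext i
  refine Fin.cases rfl (fun i => ?_) i
  simp [liftTSub, VTy.ren]

mutual
  theorem VTy.subst_var {n : ℕ} : (A : VTy n) → A.subst VTy.var = A
    | .var i => by simp only [VTy.subst]
    | .unit => by simp only [VTy.subst]
    | .prod A B => by simp only [VTy.subst, VTy.subst_var A, VTy.subst_var B]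
    | .variant L A => by simp only [VTy.subst, fun l => VTy.subst_var (A l)]
    | .U E C => by simp only [VTy.subst, Eff.subst_var E, CTy.subst_var C]
  theorem CTy.subst_var {n : ℕ} : (C : CTy n) → C.subst VTy.var = C
    | .F A => by simp only [CTy.subst, VTy.subst_var A]
    | .arr A C => by simp only [CTy.subst, VTy.subst_var A, CTy.subst_var C]
    | .prod C D => by simp only [CTy.subst, CTy.subst_var C, CTy.subst_var D]
  theorem Eff.subst_var {n : ℕ} : (E : Eff n) → E.subst VTy.var = E
    | .pure => by simp only [Eff.subst]
    | .layer E C Nu Nb => by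
        simp only [Eff.subst, Eff.subst_var E, liftTSub_var, CTy.subst_var C]
end

theorem CTy.inst_ren {n k : ℕ} (ρ : Fin n → Fin k) (C : CTy (n + 1)) (A : VTy n) :
    (C.ren (liftRen ρ)).inst (A.ren ρ) = (C.inst A).ren ρ := by
  simp only [CTy.inst, CTy.subst_ren, CTy.ren_subst, scons_liftRen, scons_comp, VTy.ren]

/-- The result type of reification and the premise of reflection are instances $C[A/\alpha]$; this
keeps both rules stable under type substitution. -/
theorem CTy.inst_subst {n k : ℕ} (σ : Fin n → VTy k) (C : CTy (n + 1)) (A : VTy n) :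
    (C.subst (liftTSub σ)).inst (A.subst σ) = (C.inst A).subst σ := by
  simp only [CTy.inst, CTy.subst_subst]
  congr 1
  funext i
  refine Fin.cases rfl (fun i => ?_) i
  simp [liftTSub, VTy.subst_ren, VTy.subst, VTy.subst_var]

theorem Eff.wk1_ren {n k : ℕ} (ρ : Fin n → Fin k) (E : Eff n) :
    (E.ren ρ).wk1 = E.wk1.ren (liftRen ρ) := by
  simp only [Eff.wk1, Eff.ren_ren, liftRen, scons_succ]

theorem Eff.wk2_ren {n k : ℕ} (ρ : Fin n → Fin k) (E : Eff n) :
    (E.ren ρ).wk2 = E.wk2.ren (liftRen (liftRen ρ)) := by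
  simp only [Eff.wk2, Eff.ren_ren, liftRen, scons_succ]

theorem CTy.at1_ren {n k : ℕ} (ρ : Fin n → Fin k) (C : CTy (n + 1)) :
    (C.ren (liftRen ρ)).at1 = C.at1.ren (liftRen (liftRen ρ)) := by
  simp only [CTy.at1, CTy.ren_ren]
  congr 1
  funext i
  exact Fin.cases rfl (fun _ => rfl) i

theorem CTy.at2_ren {n k : ℕ} (ρ : Fin n → Fin k) (C : CTy (n + 1)) :
    (C.ren (liftRen ρ)).at2 = C.at2.ren (liftRen (liftRen ρ)) := by
  simp only [CTy.at2, CTy.ren_ren]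
  congr 1
  funext i
  exact Fin.cases rfl (fun _ => rfl) i

theorem Eff.wk1_subst {n k : ℕ} (σ : Fin n → VTy k) (E : Eff n) :
    (E.subst σ).wk1 = E.wk1.subst (liftTSub σ) := by
  simp only [Eff.wk1, Eff.ren_subst, Eff.subst_ren, liftTSub, scons_succ]

theorem Eff.wk2_subst {n k : ℕ} (σ : Fin n → VTy k) (E : Eff n) :
    (E.subst σ).wk2 = E.wk2.subst (liftTSub (liftTSub σ)) := by
  simp only [Eff.wk2, Eff.ren_subst, Eff.subst_ren, liftTSub, scons_succ, VTy.ren_ren]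

theorem CTy.at1_subst {n k : ℕ} (σ : Fin n → VTy k) (C : CTy (n + 1)) :
    (C.subst (liftTSub σ)).at1 = C.at1.subst (liftTSub (liftTSub σ)) := by
  simp only [CTy.at1, CTy.ren_subst, CTy.subst_ren]
  congr 1
  funext i
  refine Fin.cases ?_ (fun _ => ?_) i
  · simp [liftTSub, VTy.ren]
  · simp [liftTSub, VTy.ren_ren]

theorem CTy.at2_subst {n k : ℕ} (σ : Fin n → VTy k) (C : CTy (n + 1)) :
    (C.subst (liftTSub σ)).at2 = C.at2.subst (liftTSub (liftTSub σ)) := by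
  simp only [CTy.at2, CTy.ren_subst, CTy.subst_ren]
  congr 1
  funext i
  refine Fin.cases ?_ (fun _ => ?_) i
  · simp [liftTSub, VTy.ren]
  · simp [liftTSub, VTy.ren_ren]

theorem Eff.wk1_inst {n : ℕ} (E : Eff n) (A : VTy n) :
    E.wk1.subst (scons A VTy.var) = E := by
  simp only [Eff.wk1, Eff.subst_ren, scons_succ, Eff.subst_var]

theorem Eff.wk2_inst {n : ℕ} (E : Eff n) (A B : VTy n) :
    E.wk2.subst (scons B (scons A VTy.var)) = E := by
  simp only [Eff.wk2, Eff.subst_ren, scons_succ, Eff.subst_var]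

/-- Index `0` is $\alpha_2$ and index `1` is $\alpha_1$, so this substitution sends $\alpha_1$ to
`A` and $\alpha_2$ to `B`. Together with its neighbours it turns the generic typing of the Kleisli
extension into the one needed at two given types. -/
theorem CTy.at1_inst {n : ℕ} (C : CTy (n + 1)) (A B : VTy n) :
    C.at1.subst (scons B (scons A VTy.var)) = C.inst A := by
  simp only [CTy.at1, CTy.inst, CTy.subst_ren]
  congr 1
  funext i
  exact Fin.cases rfl (fun _ => rfl) i

theorem CTy.at2_inst {n : ℕ} (C : CTy (n + 1)) (A B : VTy n) :
    C.at2.subst (scons B (scons A VTy.var)) = C.inst B := by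
  simp only [CTy.at2, CTy.inst, CTy.subst_ren]
  congr 1
  funext i
  exact Fin.cases rfl (fun _ => rfl) i

/-! ### Determinism of reduction -/

/-- Add an outermost frame to a hoisting context. -/
def HCtx.cons {m : ℕ} (B : BFrame m) : HCtx m → HCtx m
  | .hole => .push .hole B
  | .push H B' => .push (H.cons B) B'

theorem HCtx.plug_cons {m : ℕ} (B : BFrame m) :
    (H : HCtx m) → (M : Comp m) → (H.cons B).plug M = B.plug (H.plug M)
  | .hole, _ => rfl
  | .push H _, _ => by simp only [HCtx.cons, HCtx.plug, HCtx.plug_cons B H]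

/-- The decomposition of a computation as `H[reflect N]`, if it has this form. -/
def Comp.hoist {m : ℕ} : Comp m → Option (HCtx m × Comp m)
  | .reflect N => some (.hole, N)
  | .bind M N => M.hoist.map fun p => (p.1.cons (.bind N), p.2)
  | .app M V => M.hoist.map fun p => (p.1.cons (.app V), p.2)
  | .fst M => M.hoist.map fun p => (p.1.cons .fst, p.2)
  | .snd M => M.hoist.map fun p => (p.1.cons .snd, p.2)
  | _ => none

theorem Comp.hoist_plug {m : ℕ} (B : BFrame m) (M : Comp m) :
    (B.plug M).hoist = M.hoist.map fun p => (p.1.cons B, p.2) := by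
  cases B <;> simp only [BFrame.plug, Comp.hoist]

/-- The hoisting context `H[H']`. -/
def HCtx.comp {m : ℕ} (H : HCtx m) : HCtx m → HCtx m
  | .hole => H
  | .push H' B => .push (H.comp H') B

theorem HCtx.plug_comp {m : ℕ} (H : HCtx m) :
    (H' : HCtx m) → (M : Comp m) → (H.comp H').plug M = H.plug (H'.plug M)
  | .hole, _ => rfl
  | .push H' _, _ => by simp only [HCtx.comp, HCtx.plug, HCtx.plug_comp H H']

/-- Contexts grow at the hole, whereas `Comp.hoist` peels frames off from the outside; this
reconciles the two orders. -/
theorem HCtx.comp_cons {m : ℕ} (H : HCtx m) (B : BFrame m) :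
    (H' : HCtx m) → H.comp (H'.cons B) = (H.push B).comp H'
  | .hole => rfl
  | .push H' _ => by simp only [HCtx.cons, HCtx.comp, HCtx.comp_cons H B H']

theorem HCtx.comp_hole {m : ℕ} : (H : HCtx m) → HCtx.hole.comp H = H
  | .hole => rfl
  | .push H _ => by simp only [HCtx.comp, HCtx.comp_hole H]

theorem Comp.hoist_hplug {m : ℕ} : (H : HCtx m) → (M : Comp m) →
    (H.plug M).hoist = M.hoist.map fun p => (H.comp p.1, p.2)
  | .hole, M => by
      simp only [HCtx.plug, HCtx.comp_hole]
      exact (Option.map_id' ..).symm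
  | .push H B, M => by
      simp only [HCtx.plug, Comp.hoist_hplug H, Comp.hoist_plug, Option.map_map,
        Function.comp_def, HCtx.comp_cons]

/-- Unique decomposition: the redex determines both $H$ and $N$, so the rule for $\mathbf{reflect}$
leaves no choice. -/
theorem Comp.hoist_hplug_reflect {m : ℕ} (H : HCtx m) (N : Comp m) :
    (H.plug (.reflect N)).hoist = some (H, N) := by
  simp [Comp.hoist_hplug, Comp.hoist, HCtx.comp]

/-- The reduct of a computation, if it has one. -/
def Comp.next {m : ℕ} : Comp m → Option (Comp m)
  | .split (.pair V W) M => some (M.subst (scons V (scons W Val.var)))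
  | .case (.inj l V) L M => if hl : l ∈ L then some ((M ⟨l, hl⟩).subst1 V) else none
  | .force (.thunk M) => some M
  | .bind M N =>
      match M with
      | .ret V => some (N.subst1 V)
      | M => M.next.map fun P => .bind P N
  | .app M V =>
      match M with
      | .lam M => some (M.subst1 V)
      | M => M.next.map fun P => .app P V
  | .fst M =>
      match M with
      | .cpair M _ => some M
      | M => M.next.map fun P => .fst P
  | .snd M =>
      match M with
      | .cpair _ N => some N
      | M => M.next.map fun P => .snd P
  | .reify Nu Nb M =>
      match M.hoist with
      | some (H, N) => some (Nb.subst (scons (.thunk N)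
          (scons (.thunk (.lam (.reify Nu Nb ((H.ren Fin.succ).plug (.ret (.var 0))))))
            Fin.elim0)))
      | none =>
        match M with
        | .ret V => some (Nu.subst (scons V Fin.elim0))
        | M => M.next.map fun P => .reify Nu Nb P
  | _ => none

/-- A computation with a reduct is not an introduction form, so the frame cannot form a redex with
it. -/
theorem Comp.next_plug {m : ℕ} (B : BFrame m) {M N : Comp m} (h : M.next = some N) :
    (B.plug M).next = some (B.plug N) := by
  cases B <;> cases M <;> simp_all [BFrame.plug, Comp.next]

/-- A computation blocked on a reflection does not reduce by itself. Hence, under a reification,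
capturing the context never competes with reducing inside. -/
theorem Comp.next_of_hoist {m : ℕ} : (M : Comp m) → M.hoist.isSome → M.next = none
  | .reflect N, _ => by simp only [Comp.next]
  | .bind M N, h => by
      have := Comp.next_of_hoist M (by simpa [Comp.hoist] using h)
      cases M <;> simp_all [Comp.next, Comp.hoist]
  | .app M V, h => by
      have := Comp.next_of_hoist M (by simpa [Comp.hoist] using h)
      cases M <;> simp_all [Comp.next, Comp.hoist]
  | .fst M, h => by
      have := Comp.next_of_hoist M (by simpa [Comp.hoist] using h)
      cases M <;> simp_all [Comp.next, Comp.hoist]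
  | .snd M, h => by
      have := Comp.next_of_hoist M (by simpa [Comp.hoist] using h)
      cases M <;> simp_all [Comp.next, Comp.hoist]

theorem Comp.next_reify {m : ℕ} (Nu : Comp 1) (Nb : Comp 2) {M N : Comp m}
    (h : M.next = some N) : (Comp.reify Nu Nb M).next = some (.reify Nu Nb N) := by
  have hM : M.hoist = none := by
    by_contra hne
    simp [Comp.next_of_hoist M (Option.isSome_iff_ne_none.2 hne)] at h
  cases M <;> simp_all [Comp.next]

theorem Beta.next_eq {m : ℕ} {M N : Comp m} (h : Beta M N) : M.next = some N := by
  cases h with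
  | reflect Nu Nb H N =>
    unfold Comp.next
    simp only [Comp.hoist_hplug_reflect]
  | case l V L M hl => simp only [Comp.next, dif_pos hl]
  | _ => simp only [Comp.next, Comp.hoist]

theorem ECtx.next_plug {m : ℕ} : (E : ECtx m) → {M N : Comp m} → M.next = some N →
    (E.plug M).next = some (E.plug N)
  | .hole, _, _, h => h
  | .push E B, _, _, h => ECtx.next_plug E (Comp.next_plug B h)
  | .reify E Nu Nb, _, _, h => ECtx.next_plug E (Comp.next_reify Nu Nb h)

/-- Only this inclusion of reduction in the graph of `Comp.next` is needed for determinism. -/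
theorem Step.next_eq {m : ℕ} {M N : Comp m} (h : Step M N) : M.next = some N := by
  obtain ⟨E, h⟩ := h
  exact E.next_plug h.next_eq

theorem Step.deterministic {m : ℕ} {M N N' : Comp m} (h : Step M N) (h' : Step M N') :
    N = N' :=
  Option.some.inj (h.next_eq.symm.trans h'.next_eq)

theorem not_step_ret {m : ℕ} (V : Val m) (N : Comp m) : ¬ Step (.ret V) N := fun h => by
  simpa [Comp.next] using h.next_eq

theorem not_diverges_of_reduces {m : ℕ} {M : Comp m} {V : Val m}
    (h : Relation.ReflTransGen Step M (.ret V)) : ¬ Diverges M := by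
  -- By determinism every reduction sequence follows the given one, so its length plus one bounds
  -- all of them; the base value is `1` because a returned value admits no step.
  suffices ∃ k, ∀ N, ¬ StepN k M N by
    obtain ⟨k, hk⟩ := this
    exact fun hd => (hd k).elim hk
  induction h using Relation.ReflTransGen.head_induction_on with
  | refl => exact ⟨1, fun N ⟨P, hP, _⟩ => not_step_ret V P hP⟩
  | head h _ ih =>
    obtain ⟨k, hk⟩ := ih
    refine ⟨k + 1, fun N ⟨P, hP, hN⟩ => hk N ?_⟩
    rwa [h.deterministic hP]

theorem reduces_ret_unique {m : ℕ} {M : Comp m} {V W : Val m}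
    (h : Relation.ReflTransGen Step M (.ret V)) (h' : Relation.ReflTransGen Step M (.ret W)) :
    V = W := by
  induction h using Relation.ReflTransGen.head_induction_on with
  | refl =>
    rcases h'.cases_head with h | ⟨P, hP, _⟩
    · exact Comp.ret.inj h
    · exact (not_step_ret V P hP).elim
  | head h _ ih =>
    rcases h'.cases_head with rfl | ⟨P, hP, hPW⟩
    · exact (not_step_ret W _ h).elim
    · exact ih (h.deterministic hP ▸ hPW)

/-! ### Reduction in context -/

/-- Evaluation contexts are extended at the hole, so adding an outermost frame means rebuilding the
context from its other end. -/
theorem ECtx.exists_plug_frame {m : ℕ} (B : BFrame m) : (E : ECtx m) →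
    ∃ E' : ECtx m, ∀ M, E'.plug M = B.plug (E.plug M)
  | .hole => ⟨.push .hole B, fun _ => rfl⟩
  | .push E B' => by
      obtain ⟨E', h⟩ := ECtx.exists_plug_frame B E
      exact ⟨.push E' B', fun M => h _⟩
  | .reify E Nu Nb => by
      obtain ⟨E', h⟩ := ECtx.exists_plug_frame B E
      exact ⟨.reify E' Nu Nb, fun M => h _⟩

theorem ECtx.exists_plug_reify {m : ℕ} (Nu : Comp 1) (Nb : Comp 2) : (E : ECtx m) →
    ∃ E' : ECtx m, ∀ M, E'.plug M = .reify Nu Nb (E.plug M)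
  | .hole => ⟨.reify .hole Nu Nb, fun _ => rfl⟩
  | .push E B' => by
      obtain ⟨E', h⟩ := ECtx.exists_plug_reify Nu Nb E
      exact ⟨.push E' B', fun M => h _⟩
  | .reify E Nu' Nb' => by
      obtain ⟨E', h⟩ := ECtx.exists_plug_reify Nu Nb E
      exact ⟨.reify E' Nu' Nb', fun M => h _⟩

theorem Step.frame {m : ℕ} (B : BFrame m) {M N : Comp m} (h : Step M N) :
    Step (B.plug M) (B.plug N) := by
  obtain ⟨E, h⟩ := h
  obtain ⟨E', hE⟩ := E.exists_plug_frame B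
  rw [← hE, ← hE]
  exact ⟨E', h⟩

theorem Step.reify {m : ℕ} (Nu : Comp 1) (Nb : Comp 2) {M N : Comp m} (h : Step M N) :
    Step (.reify Nu Nb M) (.reify Nu Nb N) := by
  obtain ⟨E, h⟩ := h
  obtain ⟨E', hE⟩ := E.exists_plug_reify Nu Nb
  rw [← hE, ← hE]
  exact ⟨E', h⟩

theorem Beta.step {m : ℕ} {M N : Comp m} (h : Beta M N) : Step M N := .mk .hole h

theorem Step.hctx {m : ℕ} : (H : HCtx m) → {M N : Comp m} → Step M N →
    Step (H.plug M) (H.plug N)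
  | .hole, _, _, h => h
  | .push H B, _, _, h => Step.hctx H (h.frame B)

/-! ### The logical predicates -/

/-- Sets of closed computations that are closed under expansion. -/
def ExpansionClosed (P : Set (Comp 0)) : Prop := ∀ ⦃M N⦄, Step M N → N ∈ P → M ∈ P

theorem ExpansionClosed.reduces {P : Set (Comp 0)} (hP : ExpansionClosed P) {M N : Comp 0}
    (h : Relation.ReflTransGen Step M N) (hN : N ∈ P) : M ∈ P := by
  induction h using Relation.ReflTransGen.head_induction_on with
  | refl => exact hN
  | head h _ ih => exact hP h ih

/-- The computations that either return a value in `X`, or evaluate to `H[reflect N]` with `N`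
in `S Y` and with `H[return V]` again of this kind for all `V` in `Y`, for some `Y`. -/
inductive Reflecting (S : Set (Val 0) → Set (Comp 0)) (X : Set (Val 0)) : Comp 0 → Prop
  | ret {M : Comp 0} (V : Val 0) (hV : V ∈ X)
      (h : Relation.ReflTransGen Step M (.ret V)) : Reflecting S X M
  -- `Y` stands for the reducible values of the type at which the reflection takes place. That type
  -- is unrelated to `X` and may be arbitrarily large, so it enters only as a set.
  | reflect {M : Comp 0} (Y : Set (Val 0)) (H : HCtx 0) (N : Comp 0)
      (h : Relation.ReflTransGen Step M (H.plug (.reflect N))) (hN : N ∈ S Y)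
      (hH : ∀ V ∈ Y, Reflecting S X (H.plug (.ret V))) : Reflecting S X M

mutual
  /-- The closed values that are reducible at a type. -/
  def VTy.red {n : ℕ} (θ : Fin n → Set (Val 0)) : VTy n → Set (Val 0)
    | .var a => θ a
    | .unit => {.unit}
    | .prod A B => {V | ∃ V₁ ∈ A.red θ, ∃ V₂ ∈ B.red θ, V = .pair V₁ V₂}
    | .variant L A => {V | ∃ l : L, ∃ W ∈ (A l).red θ, V = .inj l W}
    | .U E C => {V | ∃ M ∈ C.red θ (E.red θ), V = .thunk M}
  /-- The closed computations that are reducible at a type, for an effect at which the reducible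
  returners are given by `R`. -/
  def CTy.red {n : ℕ} (θ : Fin n → Set (Val 0)) :
      CTy n → (Set (Val 0) → Set (Comp 0)) → Set (Comp 0)
    | .F A, R => R (A.red θ)
    | .arr A C, R => {M | ∀ V ∈ A.red θ, .app M V ∈ C.red θ R}
    | .prod C D, R => {M | .fst M ∈ C.red θ R ∧ .snd M ∈ D.red θ R}
  /-- The closed returners of values in a given set that are reducible at an effect. -/
  def Eff.red {n : ℕ} (θ : Fin n → Set (Val 0)) : Eff n → Set (Val 0) → Set (Comp 0)
    | .pure, X => {M | ∃ V ∈ X, Relation.ReflTransGen Step M (.ret V)}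
    -- The type constructor of the monad is applied to all sets of closed values at once; its unit
    -- and Kleisli extension play no role.
    | .layer E C _ _, X => {M | Reflecting (fun Y => C.red (scons Y θ) (E.red θ)) X M}
end

-- Reducibility under renaming and substitution of types

mutual
  theorem VTy.red_ren {n k : ℕ} (ρ : Fin n → Fin k) (θ : Fin k → Set (Val 0)) :
      (A : VTy n) → (A.ren ρ).red θ = A.red (fun a => θ (ρ a))
    | .var a => by simp only [VTy.ren, VTy.red]
    | .unit => by simp only [VTy.ren, VTy.red]
    | .prod A B => by simp only [VTy.ren, VTy.red, VTy.red_ren ρ θ A, VTy.red_ren ρ θ B]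
    | .variant L A => by simp only [VTy.ren, VTy.red, fun l => VTy.red_ren ρ θ (A l)]
    | .U E C => by simp only [VTy.ren, VTy.red, CTy.red_ren ρ θ C, Eff.red_ren ρ θ E]
  theorem CTy.red_ren {n k : ℕ} (ρ : Fin n → Fin k) (θ : Fin k → Set (Val 0)) :
      (C : CTy n) → (C.ren ρ).red θ = C.red (fun a => θ (ρ a))
    | .F A => by
        funext R
        simp only [CTy.ren, CTy.red, VTy.red_ren ρ θ A]
    | .arr A C => by
        funext R
        simp only [CTy.ren, CTy.red, VTy.red_ren ρ θ A, CTy.red_ren ρ θ C]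
    | .prod C D => by
        funext R
        simp only [CTy.ren, CTy.red, CTy.red_ren ρ θ C, CTy.red_ren ρ θ D]
  theorem Eff.red_ren {n k : ℕ} (ρ : Fin n → Fin k) (θ : Fin k → Set (Val 0)) :
      (E : Eff n) → (E.ren ρ).red θ = E.red (fun a => θ (ρ a))
    | .pure => by
        funext X
        simp only [Eff.ren, Eff.red]
    | .layer E C Nu Nb => by
        funext X
        simp only [Eff.ren, Eff.red, fun Y => CTy.red_ren (liftRen ρ) (scons Y θ) C,
          Eff.red_ren ρ θ E, scons_liftRen]
end

theorem red_liftTSub {n k : ℕ} (σ : Fin n → VTy k) (θ : Fin k → Set (Val 0))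
    (X : Set (Val 0)) :
    (fun a => (liftTSub σ a).red (scons X θ)) = scons X (fun a => (σ a).red θ) := by
  funext a
  refine Fin.cases (by simp [liftTSub, VTy.red]) (fun a => ?_) a
  simp [liftTSub, VTy.red_ren]

mutual
  -- Type variables range over all sets of closed values, so the interpretation of a type is itself
  -- an admissible value for a variable and no candidate condition has to be checked.
  theorem VTy.red_subst {n k : ℕ} (σ : Fin n → VTy k) (θ : Fin k → Set (Val 0)) :
      (A : VTy n) → (A.subst σ).red θ = A.red (fun a => (σ a).red θ)
    | .var a => by simp only [VTy.subst, VTy.red]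
    | .unit => by simp only [VTy.subst, VTy.red]
    | .prod A B => by
        simp only [VTy.subst, VTy.red, VTy.red_subst σ θ A, VTy.red_subst σ θ B]
    | .variant L A => by simp only [VTy.subst, VTy.red, fun l => VTy.red_subst σ θ (A l)]
    | .U E C => by simp only [VTy.subst, VTy.red, CTy.red_subst σ θ C, Eff.red_subst σ θ E]
  theorem CTy.red_subst {n k : ℕ} (σ : Fin n → VTy k) (θ : Fin k → Set (Val 0)) :
      (C : CTy n) → (C.subst σ).red θ = C.red (fun a => (σ a).red θ)
    | .F A => by
        funext R
        simp only [CTy.subst, CTy.red, VTy.red_subst σ θ A]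
    | .arr A C => by
        funext R
        simp only [CTy.subst, CTy.red, VTy.red_subst σ θ A, CTy.red_subst σ θ C]
    | .prod C D => by
        funext R
        simp only [CTy.subst, CTy.red, CTy.red_subst σ θ C, CTy.red_subst σ θ D]
  theorem Eff.red_subst {n k : ℕ} (σ : Fin n → VTy k) (θ : Fin k → Set (Val 0)) :
      (E : Eff n) → (E.subst σ).red θ = E.red (fun a => (σ a).red θ)
    | .pure => by
        funext X
        simp only [Eff.subst, Eff.red]
    | .layer E C Nu Nb => by
        funext X
        simp only [Eff.subst, Eff.red, fun Y => CTy.red_subst (liftTSub σ) (scons Y θ) C,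
          Eff.red_subst σ θ E, red_liftTSub]
end

theorem Eff.red_wk1 {n : ℕ} (E : Eff n) (θ : Fin n → Set (Val 0)) (X : Set (Val 0)) :
    E.wk1.red (scons X θ) = E.red θ :=
  Eff.red_ren Fin.succ (scons X θ) E

theorem Eff.red_wk2 {n : ℕ} (E : Eff n) (θ : Fin n → Set (Val 0)) (X Y : Set (Val 0)) :
    E.wk2.red (scons Y (scons X θ)) = E.red θ :=
  Eff.red_ren (fun a => a.succ.succ) (scons Y (scons X θ)) E

theorem CTy.red_at1 {n : ℕ} (C : CTy (n + 1)) (θ : Fin n → Set (Val 0))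
    (X Y : Set (Val 0)) : C.at1.red (scons Y (scons X θ)) = C.red (scons X θ) := by
  refine (CTy.red_ren _ _ C).trans (congrArg (fun t => CTy.red t C) ?_)
  funext a
  exact Fin.cases rfl (fun _ => rfl) a

theorem CTy.red_at2 {n : ℕ} (C : CTy (n + 1)) (θ : Fin n → Set (Val 0))
    (X Y : Set (Val 0)) : C.at2.red (scons Y (scons X θ)) = C.red (scons Y θ) := by
  refine (CTy.red_ren _ _ C).trans (congrArg (fun t => CTy.red t C) ?_)
  funext a
  exact Fin.cases rfl (fun _ => rfl) a

theorem CTy.red_inst {n : ℕ} (C : CTy (n + 1)) (A : VTy n) (θ : Fin n → Set (Val 0)) :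
    (C.inst A).red θ = C.red (scons (A.red θ) θ) := by
  simp only [CTy.inst, CTy.red_subst, scons_comp, VTy.red]

-- Closure properties of the reducible sets

theorem Eff.red_expansionClosed {n : ℕ} (θ : Fin n → Set (Val 0)) (X : Set (Val 0)) :
    (E : Eff n) → ExpansionClosed (E.red θ X)
  | .pure, M, N, h, ⟨V, hV, hN⟩ => ⟨V, hV, .head h hN⟩
  | .layer .., M, N, h, hN => by
      cases hN with
      | ret V hV hN => exact .ret V hV (.head h hN)
      | reflect Y H P hN hP hH => exact .reflect Y H P (.head h hN) hP hH

/-- A step may be taken under the eliminator frames, which reduces functions and pairs to the case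
of returners. There, membership starts with a reduction sequence that can be prolonged at its front.
-/
theorem CTy.red_expansionClosed {n : ℕ} (θ : Fin n → Set (Val 0)) (E : Eff n) :
    (C : CTy n) → ExpansionClosed (C.red θ (E.red θ))
  | .F _ => Eff.red_expansionClosed θ _ E
  | .arr _ C => fun _ _ h hN V hV =>
      CTy.red_expansionClosed θ E C (h.frame (.app V)) (hN V hV)
  | .prod C D => fun _ _ h hN =>
      ⟨CTy.red_expansionClosed θ E C (h.frame .fst) hN.1,
        CTy.red_expansionClosed θ E D (h.frame .snd) hN.2⟩

theorem HCtx.reduces_plug {m : ℕ} (H : HCtx m) {M N : Comp m}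
    (h : Relation.ReflTransGen Step M N) :
    Relation.ReflTransGen Step (H.plug M) (H.plug N) :=
  h.lift H.plug fun _ _ => Step.hctx H

/-- Over a layer, this grafts trees: the leaves of `M` are replaced by the trees of `H.plug (.ret
V)`, and at a node the captured context grows from $H'$ to $H[H']$. At the empty effect `M` simply
evaluates inside `H`. -/
theorem Eff.red_plug {n : ℕ} (θ : Fin n → Set (Val 0)) (X Y : Set (Val 0)) (H : HCtx 0)
    {M : Comp 0} : (E : Eff n) → M ∈ E.red θ X → (∀ V ∈ X, H.plug (.ret V) ∈ E.red θ Y) →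
    H.plug M ∈ E.red θ Y
  | .pure, ⟨V, hV, hM⟩, hH =>
      (Eff.red_expansionClosed θ Y .pure).reduces (HCtx.reduces_plug H hM) (hH V hV)
  | .layer E C Nu Nb, hM, hH => by
      induction hM with
      | ret V hV h =>
        exact (Eff.red_expansionClosed θ Y _).reduces (HCtx.reduces_plug H h) (hH V hV)
      | reflect Z H' N h hN _ ih =>
        refine .reflect Z (H.comp H') N ?_ hN fun V hV => ?_
        · rw [HCtx.plug_comp]
          exact HCtx.reduces_plug H h
        · rw [HCtx.plug_comp]
          exact ih V hV

/-- Reducible returners may be sequenced with computations of arbitrary types. -/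
theorem CTy.red_plug {n : ℕ} (θ : Fin n → Set (Val 0)) (E : Eff n) (X : Set (Val 0))
    {M : Comp 0} (hM : M ∈ E.red θ X) : (C : CTy n) → (H : HCtx 0) →
    (∀ V ∈ X, H.plug (.ret V) ∈ C.red θ (E.red θ)) → H.plug M ∈ C.red θ (E.red θ)
  | .F _, H, hH => Eff.red_plug θ X _ H E hM hH
  | .arr _ C, H, hH => fun W hW => by
      -- The eliminator testing the result is absorbed into the context as its outermost frame; this
      -- is why the statement needs arbitrary `H`.
      have := CTy.red_plug θ E X hM C (H.cons (.app W)) fun V hV => by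
        rw [HCtx.plug_cons]
        exact hH V hV W hW
      rwa [HCtx.plug_cons] at this
  | .prod C D, H, hH => by
      constructor
      · have := CTy.red_plug θ E X hM C (H.cons .fst) fun V hV => by
          rw [HCtx.plug_cons]
          exact (hH V hV).1
        rwa [HCtx.plug_cons] at this
      · have := CTy.red_plug θ E X hM D (H.cons .snd) fun V hV => by
          rw [HCtx.plug_cons]
          exact (hH V hV).2
        rwa [HCtx.plug_cons] at this

theorem Eff.ret_mem_red {n : ℕ} (θ : Fin n → Set (Val 0)) {X : Set (Val 0)} {V : Val 0}
    (hV : V ∈ X) : (E : Eff n) → .ret V ∈ E.red θ X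
  | .pure => ⟨V, hV, .refl⟩
  | .layer .. => .ret V hV .refl

/-- Reification of a reducible returner is reducible, if the unit and the Kleisli extension
preserve reducibility. -/
theorem Reflecting.reify {S : Set (Val 0) → Set (Comp 0)} {X : Set (Val 0)}
    {Nu : Comp 1} {Nb : Comp 2} (hS : ExpansionClosed (S X))
    (hu : ∀ V ∈ X, Nu.subst (scons V Fin.elim0) ∈ S X)
    (hb : ∀ Y, ∀ N ∈ S Y, ∀ K, (∀ V ∈ Y, .app K V ∈ S X) →
      Nb.subst (scons (.thunk N) (scons (.thunk K) Fin.elim0)) ∈ S X)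
    {M : Comp 0} (hM : Reflecting S X M) : .reify Nu Nb M ∈ S X := by
  induction hM with
  | ret V hV h =>
    exact hS.reduces (h.lift (Comp.reify Nu Nb) fun _ _ => Step.reify Nu Nb)
      (hS (Beta.reify Nu Nb V).step (hu V hV))
  | reflect Y H N h hN _ ih =>
    refine hS.reduces (h.lift (Comp.reify Nu Nb) fun _ _ => Step.reify Nu Nb)
      (hS (Beta.reflect Nu Nb H N).step (hb Y N hN _ fun V hV => ?_))
    -- The captured continuation applied to `V` reduces to $[H[\mathbf{return}\,V]]^T$, the
    -- reification of a subtree, to which the induction hypothesis applies.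
    refine hS (Beta.app _ V).step ?_
    simp only [Comp.subst1, Comp.subst, HCtx.subst_plug_ren_succ, Val.subst, scons_zero]
    exact ih V hV

/-- Closing substitutions by reducible values. -/
def Ctx.red {n m : ℕ} (Γ : Ctx n m) (θ : Fin n → Set (Val 0)) : Set (Fin m → Val 0) :=
  {γ | ∀ i, γ i ∈ (Γ i).red θ}

theorem Ctx.scons_mem_red {n m : ℕ} {Γ : Ctx n m} {θ : Fin n → Set (Val 0)}
    {γ : Fin m → Val 0} {A : VTy n} {V : Val 0} (hV : V ∈ A.red θ) (hγ : γ ∈ Γ.red θ) :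
    scons V γ ∈ Ctx.red (scons A Γ) θ :=
  fun i => Fin.cases (motive := fun i => scons V γ i ∈ (scons A Γ i).red θ) hV hγ i

theorem Ctx.nil_mem_red {n : ℕ} (θ : Fin n → Set (Val 0)) (γ : Fin 0 → Val 0) :
    γ ∈ Ctx.red Ctx.nil θ :=
  fun i => i.elim0

mutual
  /-- Well-typed values are reducible. -/
  theorem TVal.subst_mem_red : {n m : ℕ} → {Γ : Ctx n m} → {V : Val m} → {A : VTy n} →
      TVal Γ V A → (θ : Fin n → Set (Val 0)) → (γ : Fin m → Val 0) → γ ∈ Γ.red θ →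
      V.subst γ ∈ A.red θ
    | _, _, Γ, _, .(Γ i), .var _ i, _, _, hγ => hγ i
    | _, _, _, _, _, .unit _, _, _, _ => rfl
    | _, _, _, _, _, .pair dV dW, θ, γ, hγ =>
        ⟨_, dV.subst_mem_red θ γ hγ, _, dW.subst_mem_red θ γ hγ, rfl⟩
    | _, _, _, _, _, .inj _ l dV, θ, γ, hγ => ⟨l, _, dV.subst_mem_red θ γ hγ, rfl⟩
    | _, _, _, _, _, .thunk dM, θ, γ, hγ => ⟨_, dM.subst_mem_red θ γ hγ, rfl⟩
  /-- Well-typed computations are reducible. -/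
  theorem TComp.subst_mem_red : {n m : ℕ} → {Γ : Ctx n m} → {E : Eff n} → {M : Comp m} →
      {C : CTy n} → TComp Γ E M C → (θ : Fin n → Set (Val 0)) → (γ : Fin m → Val 0) →
      γ ∈ Γ.red θ → M.subst γ ∈ C.red θ (E.red θ)
    | _, _, _, E, _, C, .split (V := V) (M := M) dV dM, θ, γ, hγ => by
        obtain ⟨V₁, h₁, V₂, h₂, h⟩ := dV.subst_mem_red θ γ hγ
        have := dM.subst_mem_red θ _ (Ctx.scons_mem_red h₁ (Ctx.scons_mem_red h₂ hγ))
        rw [← Comp.subst_liftSub_liftSub_subst] at this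
        rw [Comp.subst, h]
        exact C.red_expansionClosed θ E (Beta.split V₁ V₂ _).step this
    | _, _, _, E, _, C, .case (L := L) (M := M) _ dV dM, θ, γ, hγ => by
        obtain ⟨l, W, hW, h⟩ := dV.subst_mem_red θ γ hγ
        have := (dM l).subst_mem_red θ _ (Ctx.scons_mem_red hW hγ)
        rw [← Comp.subst_liftSub_subst1] at this
        rw [Comp.subst, h]
        exact C.red_expansionClosed θ E
          (Beta.case l W L (fun l => (M l).subst (liftSub γ)) l.2).step this
    | _, _, _, E, _, C, .force dV, θ, γ, hγ => by
        obtain ⟨N, hN, h⟩ := dV.subst_mem_red θ γ hγ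
        rw [Comp.subst, h]
        exact C.red_expansionClosed θ E (Beta.force N).step hN
    | _, _, _, E, _, _, .ret _ dV, θ, γ, hγ => E.ret_mem_red θ (dV.subst_mem_red θ γ hγ)
    | _, _, _, E, _, C, .bind (N := N) _ dM dN, θ, γ, hγ => by
        -- The $\mathbf{let}$ is a hoisting context with one frame around the returner.
        refine C.red_plug θ E _ (dM.subst_mem_red θ γ hγ)
          (.push .hole (.bind (N.subst (liftSub γ)))) fun V hV => ?_
        refine C.red_expansionClosed θ E (Beta.bind V _).step ?_
        rw [Comp.subst_liftSub_subst1]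
        exact dN.subst_mem_red θ _ (Ctx.scons_mem_red hV hγ)
    | _, _, _, E, _, .arr _ C, .lam dM, θ, γ, hγ => fun V hV => by
        refine C.red_expansionClosed θ E (Beta.app _ V).step ?_
        rw [Comp.subst_liftSub_subst1]
        exact dM.subst_mem_red θ _ (Ctx.scons_mem_red hV hγ)
    | _, _, _, _, _, _, .app dM dV, θ, γ, hγ =>
        dM.subst_mem_red θ γ hγ _ (dV.subst_mem_red θ γ hγ)
    | _, _, _, E, _, .prod C D, .cpair dM dN, θ, γ, hγ =>
        ⟨C.red_expansionClosed θ E (Beta.fst _ _).step (dM.subst_mem_red θ γ hγ),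
          D.red_expansionClosed θ E (Beta.snd _ _).step (dN.subst_mem_red θ γ hγ)⟩
    | _, _, _, _, _, _, .fst dM, θ, γ, hγ => (dM.subst_mem_red θ γ hγ).1
    | _, _, _, _, _, _, .snd dM, θ, γ, hγ => (dM.subst_mem_red θ γ hγ).2
    | _, _, _, _, _, _, .reflect (A := A) _ _ dN, θ, γ, hγ => by
        have := dN.subst_mem_red θ γ hγ
        rw [CTy.red_inst] at this
        -- A node with empty context, whose subtrees are all leaves.
        exact .reflect (A.red θ) .hole _ .refl this fun V hV => .ret V hV .refl
    | _, _, _, E, _, _, .reify (C := C) (A := A) (.layer _ _ du db) dN, θ, γ, hγ => by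
        have hN := dN.subst_mem_red θ γ hγ
        rw [CTy.red_inst]
        -- The derivations `du` and `db` of the monad bodies sit inside the kinding premise of the
        -- rule, so the recursive calls on them are structural.
        refine Reflecting.reify (S := fun Y => C.red (scons Y θ) (E.red θ)) ?_ ?_ ?_ hN
        · have := C.red_expansionClosed (scons (A.red θ) θ) E.wk1
          rwa [Eff.red_wk1] at this
        · intro V hV
          have := du.subst_mem_red (scons (A.red θ) θ) (scons V Fin.elim0)
            (Ctx.scons_mem_red hV (Ctx.nil_mem_red _ _))
          rwa [Eff.red_wk1] at this
        · intro Y N hN K hK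
          -- Here $\alpha_2$ is the reducible values of `A` and $\alpha_1$ is `Y`, which need not
          -- interpret any type: the polymorphic typing of the Kleisli extension is essential.
          have := db.subst_mem_red (scons (A.red θ) (scons Y θ))
            (scons (.thunk N) (scons (.thunk K) Fin.elim0))
            (Ctx.scons_mem_red ?_ (Ctx.scons_mem_red ?_ (Ctx.nil_mem_red _ _)))
          · rwa [Eff.red_wk2, CTy.red_at2] at this
          · refine ⟨N, ?_, rfl⟩
            rwa [Eff.red_wk2, CTy.red_at1]
          · refine ⟨K, ?_, rfl⟩
            simp only [CTy.red, VTy.red, Eff.red_wk2, CTy.red_at2]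
            exact hK
end

theorem TComp.exists_reduces_ret {n : ℕ} {M : Comp 0} {A : VTy n}
    (d : TComp Ctx.nil Eff.pure M (.F A)) :
    ∃ V, Relation.ReflTransGen Step M (.ret V) := by
  -- Any assignment of sets to the type variables would serve; the empty sets are a convenient
  -- choice.
  obtain ⟨V, -, h⟩ := d.subst_mem_red (fun _ => ∅) Val.var (Ctx.nil_mem_red _ _)
  rw [Comp.subst_var] at h
  exact ⟨V, h⟩

/-! ### Transport and type variable instantiation of derivations -/

/-- Transport of a derivation along equalities. -/
def TVal.cast {n m : ℕ} {Γ Γ' : Ctx n m} {V : Val m} {A A' : VTy n} (d : TVal Γ V A)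
    (hΓ : Γ = Γ') (hA : A = A') : TVal Γ' V A' := by
  subst hΓ hA
  exact d

/-- Transport of a derivation along equalities. -/
def TComp.cast {n m : ℕ} {Γ Γ' : Ctx n m} {E E' : Eff n} {M : Comp m} {C C' : CTy n}
    (d : TComp Γ E M C) (hΓ : Γ = Γ') (hE : E = E') (hC : C = C') : TComp Γ' E' M C' := by
  subst hΓ hE hC
  exact d

/-- Transport of a derivation along equalities. -/
def KComp.cast {n : ℕ} {E E' : Eff n} {C C' : CTy n}
    (k : KComp E C) (hE : E = E') (hC : C = C') : KComp E' C' := by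
  subst hE hC
  exact k

theorem Ctx.map_nil {n k : ℕ} (f : VTy n → VTy k) : (fun i => f (Ctx.nil i)) = Ctx.nil :=
  funext fun i => i.elim0

mutual
  -- Kinding an effect includes typing its monad bodies, so all five kinds of derivation are treated
  -- together. The casts are due to weakening and instantiation commuting with renaming only up to
  -- propositional equality. Renaming precedes substitution because lifting a substitution under a
  -- binder renames its kinding derivations.
  def KEff.ren : {n k : ℕ} → {E : Eff n} → KEff E → (ρ : Fin n → Fin k) → KEff (E.ren ρ)
    | _, _, _, .pure, _ => .pure
    | _, _, _, .layer kE kC du db, ρ =>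
        .layer (kE.ren ρ) ((kC.ren (liftRen ρ)).cast (Eff.wk1_ren ρ _).symm rfl)
          ((du.tren (liftRen ρ)).cast
            ((scons_comp (VTy.ren _) _ _).trans (by rw [Ctx.map_nil]; rfl))
            (Eff.wk1_ren ρ _).symm rfl)
          ((db.tren (liftRen (liftRen ρ))).cast
            (by
              rw [scons_comp (VTy.ren _), scons_comp (VTy.ren _), Ctx.map_nil]
              simp only [VTy.ren, CTy.ren, Eff.wk2_ren, CTy.at1_ren, CTy.at2_ren]
              rfl)
            (Eff.wk2_ren ρ _).symm (CTy.at2_ren ρ _).symm)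
  def KVal.ren : {n k : ℕ} → {A : VTy n} → KVal A → (ρ : Fin n → Fin k) → KVal (A.ren ρ)
    | _, _, _, .var a, ρ => .var (ρ a)
    | _, _, _, .unit, _ => .unit
    | _, _, _, .prod kA kB, ρ => .prod (kA.ren ρ) (kB.ren ρ)
    | _, _, _, .variant kA, ρ => .variant fun l => (kA l).ren ρ
    | _, _, _, .U kC, ρ => .U (kC.ren ρ)
  def KComp.ren : {n k : ℕ} → {E : Eff n} → {C : CTy n} → KComp E C → (ρ : Fin n → Fin k) →
      KComp (E.ren ρ) (C.ren ρ)
    | _, _, _, _, .F kE kA, ρ => .F (kE.ren ρ) (kA.ren ρ)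
    | _, _, _, _, .arr kA kC, ρ => .arr (kA.ren ρ) (kC.ren ρ)
    | _, _, _, _, .prod kC kD, ρ => .prod (kC.ren ρ) (kD.ren ρ)
  /-- Renaming of type variables. -/
  def TVal.tren : {n k m : ℕ} → {Γ : Ctx n m} → {V : Val m} → {A : VTy n} → TVal Γ V A →
      (ρ : Fin n → Fin k) → TVal (fun i => (Γ i).ren ρ) V (A.ren ρ)
    | _, _, _, Γ, _, .(Γ i), .var kΓ i, ρ =>
        .var (Γ := fun i => (Γ i).ren ρ) (fun i => (kΓ i).ren ρ) i
    | _, _, _, _, _, _, .unit kΓ, ρ => .unit fun i => (kΓ i).ren ρ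
    | _, _, _, _, _, _, .pair dV dW, ρ => .pair (dV.tren ρ) (dW.tren ρ)
    | _, _, _, _, _, _, .inj kA l dV, ρ => .inj (kA.ren ρ) l (dV.tren ρ)
    | _, _, _, _, _, _, .thunk dM, ρ => .thunk (dM.tren ρ)
  /-- Renaming of type variables. -/
  def TComp.tren : {n k m : ℕ} → {Γ : Ctx n m} → {E : Eff n} → {M : Comp m} → {C : CTy n} →
      TComp Γ E M C → (ρ : Fin n → Fin k) →
      TComp (fun i => (Γ i).ren ρ) (E.ren ρ) M (C.ren ρ)
    | _, _, _, _, _, _, _, .split dV dM, ρ =>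
        .split (dV.tren ρ) ((dM.tren ρ).cast
          (by rw [scons_comp (VTy.ren ρ), scons_comp (VTy.ren ρ)]) rfl rfl)
    | _, _, _, _, _, _, _, .case kC dV dM, ρ =>
        .case (kC.ren ρ) (dV.tren ρ) fun l =>
          ((dM l).tren ρ).cast (scons_comp (VTy.ren ρ) _ _) rfl rfl
    | _, _, _, _, _, _, _, .force dV, ρ => .force (dV.tren ρ)
    | _, _, _, _, _, _, _, .ret kE dV, ρ => .ret (kE.ren ρ) (dV.tren ρ)
    | _, _, _, _, _, _, _, .bind kE dM dN, ρ =>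
        .bind (kE.ren ρ) (dM.tren ρ) ((dN.tren ρ).cast (scons_comp (VTy.ren ρ) _ _) rfl rfl)
    | _, _, _, _, _, _, _, .lam dM, ρ =>
        .lam ((dM.tren ρ).cast (scons_comp (VTy.ren ρ) _ _) rfl rfl)
    | _, _, _, _, _, _, _, .app dM dV, ρ => .app (dM.tren ρ) (dV.tren ρ)
    | _, _, _, _, _, _, _, .cpair dM dN, ρ => .cpair (dM.tren ρ) (dN.tren ρ)
    | _, _, _, _, _, _, _, .fst dM, ρ => .fst (dM.tren ρ)
    | _, _, _, _, _, _, _, .snd dM, ρ => .snd (dM.tren ρ)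
    | _, _, _, _, _, _, _, .reflect kT kA dN, ρ =>
        .reflect (kT.ren ρ) (kA.ren ρ) ((dN.tren ρ).cast rfl rfl (CTy.inst_ren ρ _ _).symm)
    | _, _, _, _, _, _, _, .reify kT dN, ρ =>
        (TComp.reify (kT.ren ρ) (dN.tren ρ)).cast rfl rfl (CTy.inst_ren ρ _ _)
end

/-- Lift well-kinded substitutions under a type binder. -/
def KVal.liftTSub {n k : ℕ} {σ : Fin n → VTy k} (kσ : ∀ a, KVal (σ a)) :
    ∀ a, KVal (liftTSub σ a) :=
  Fin.cases (.var 0) fun a => (kσ a).ren Fin.succ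

mutual
  def KEff.subst : {n k : ℕ} → {E : Eff n} → KEff E → {σ : Fin n → VTy k} →
      (∀ a, KVal (σ a)) → KEff (E.subst σ)
    | _, _, _, .pure, _, _ => .pure
    | _, _, _, .layer kE kC du db, σ, kσ =>
        .layer (kE.subst kσ)
          ((kC.subst (KVal.liftTSub kσ)).cast (Eff.wk1_subst σ _).symm rfl)
          ((du.tsubst (KVal.liftTSub kσ)).cast
            ((scons_comp (VTy.subst _) _ _).trans (by rw [Ctx.map_nil]; rfl))
            (Eff.wk1_subst σ _).symm rfl)
          ((db.tsubst (KVal.liftTSub (KVal.liftTSub kσ))).cast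
            (by
              rw [scons_comp (VTy.subst _), scons_comp (VTy.subst _), Ctx.map_nil]
              simp only [VTy.subst, CTy.subst, Eff.wk2_subst, CTy.at1_subst, CTy.at2_subst]
              rfl)
            (Eff.wk2_subst σ _).symm (CTy.at2_subst σ _).symm)
  def KVal.subst : {n k : ℕ} → {A : VTy n} → KVal A → {σ : Fin n → VTy k} →
      (∀ a, KVal (σ a)) → KVal (A.subst σ)
    | _, _, _, .var a, _, kσ => kσ a
    | _, _, _, .unit, _, _ => .unit
    | _, _, _, .prod kA kB, _, kσ => .prod (kA.subst kσ) (kB.subst kσ)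
    | _, _, _, .variant kA, _, kσ => .variant fun l => (kA l).subst kσ
    | _, _, _, .U kC, _, kσ => .U (kC.subst kσ)
  def KComp.subst : {n k : ℕ} → {E : Eff n} → {C : CTy n} → KComp E C →
      {σ : Fin n → VTy k} → (∀ a, KVal (σ a)) → KComp (E.subst σ) (C.subst σ)
    | _, _, _, _, .F kE kA, _, kσ => .F (kE.subst kσ) (kA.subst kσ)
    | _, _, _, _, .arr kA kC, _, kσ => .arr (kA.subst kσ) (kC.subst kσ)
    | _, _, _, _, .prod kC kD, _, kσ => .prod (kC.subst kσ) (kD.subst kσ)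
  /-- Substitution for type variables. -/
  def TVal.tsubst : {n k m : ℕ} → {Γ : Ctx n m} → {V : Val m} → {A : VTy n} → TVal Γ V A →
      {σ : Fin n → VTy k} → (∀ a, KVal (σ a)) →
      TVal (fun i => (Γ i).subst σ) V (A.subst σ)
    | _, _, _, Γ, _, .(Γ i), .var kΓ i, σ, kσ =>
        .var (Γ := fun i => (Γ i).subst σ) (fun i => (kΓ i).subst kσ) i
    | _, _, _, _, _, _, .unit kΓ, _, kσ => .unit fun i => (kΓ i).subst kσ
    | _, _, _, _, _, _, .pair dV dW, _, kσ => .pair (dV.tsubst kσ) (dW.tsubst kσ)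
    | _, _, _, _, _, _, .inj kA l dV, _, kσ => .inj (kA.subst kσ) l (dV.tsubst kσ)
    | _, _, _, _, _, _, .thunk dM, _, kσ => .thunk (dM.tsubst kσ)
  /-- Substitution for type variables. -/
  def TComp.tsubst : {n k m : ℕ} → {Γ : Ctx n m} → {E : Eff n} → {M : Comp m} →
      {C : CTy n} → TComp Γ E M C → {σ : Fin n → VTy k} → (∀ a, KVal (σ a)) →
      TComp (fun i => (Γ i).subst σ) (E.subst σ) M (C.subst σ)
    | _, _, _, _, _, _, _, .split dV dM, σ, kσ =>
        .split (dV.tsubst kσ) ((dM.tsubst kσ).cast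
          (by rw [scons_comp (VTy.subst σ), scons_comp (VTy.subst σ)]) rfl rfl)
    | _, _, _, _, _, _, _, .case kC dV dM, σ, kσ =>
        .case (kC.subst kσ) (dV.tsubst kσ) fun l =>
          ((dM l).tsubst kσ).cast (scons_comp (VTy.subst σ) _ _) rfl rfl
    | _, _, _, _, _, _, _, .force dV, _, kσ => .force (dV.tsubst kσ)
    | _, _, _, _, _, _, _, .ret kE dV, _, kσ => .ret (kE.subst kσ) (dV.tsubst kσ)
    | _, _, _, _, _, _, _, .bind kE dM dN, σ, kσ =>
        .bind (kE.subst kσ) (dM.tsubst kσ)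
          ((dN.tsubst kσ).cast (scons_comp (VTy.subst σ) _ _) rfl rfl)
    | _, _, _, _, _, _, _, .lam dM, σ, kσ =>
        .lam ((dM.tsubst kσ).cast (scons_comp (VTy.subst σ) _ _) rfl rfl)
    | _, _, _, _, _, _, _, .app dM dV, _, kσ => .app (dM.tsubst kσ) (dV.tsubst kσ)
    | _, _, _, _, _, _, _, .cpair dM dN, _, kσ => .cpair (dM.tsubst kσ) (dN.tsubst kσ)
    | _, _, _, _, _, _, _, .fst dM, _, kσ => .fst (dM.tsubst kσ)
    | _, _, _, _, _, _, _, .snd dM, _, kσ => .snd (dM.tsubst kσ)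
    | _, _, _, _, _, _, _, .reflect kT kA dN, σ, kσ =>
        .reflect (kT.subst kσ) (kA.subst kσ)
          ((dN.tsubst kσ).cast rfl rfl (CTy.inst_subst σ _ _).symm)
    | _, _, _, _, _, _, _, .reify kT dN, σ, kσ =>
        (TComp.reify (kT.subst kσ) (dN.tsubst kσ)).cast rfl rfl (CTy.inst_subst σ _ _)
end

/-- Well-kinded substitutions are extended by well-kinded types. -/
def KVal.scons {n k : ℕ} {A : VTy k} {σ : Fin n → VTy k} (kA : KVal A)
    (kσ : ∀ a, KVal (σ a)) : ∀ a, KVal (scons A σ a) :=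
  Fin.cases kA kσ

/-! ### Regularity -/

mutual
  /-- The environment of a derivable judgement is well-kinded. -/
  def TVal.ctxKind : {n m : ℕ} → {Γ : Ctx n m} → {V : Val m} → {A : VTy n} → TVal Γ V A →
      ∀ i, KVal (Γ i)
    | _, _, Γ, _, .(Γ i), .var kΓ i => kΓ
    | _, _, _, _, _, .unit kΓ => kΓ
    | _, _, _, _, _, .pair dV _ => dV.ctxKind
    | _, _, _, _, _, .inj _ _ dV => dV.ctxKind
    | _, _, _, _, _, .thunk dM => dM.ctxKind
  /-- The environment of a derivable judgement is well-kinded. -/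
  def TComp.ctxKind : {n m : ℕ} → {Γ : Ctx n m} → {E : Eff n} → {M : Comp m} →
      {C : CTy n} → TComp Γ E M C → ∀ i, KVal (Γ i)
    | _, _, _, _, _, _, .split dV _ => dV.ctxKind
    | _, _, _, _, _, _, .case _ dV _ => dV.ctxKind
    | _, _, _, _, _, _, .force dV => dV.ctxKind
    | _, _, _, _, _, _, .ret _ dV => dV.ctxKind
    | _, _, _, _, _, _, .bind _ dM _ => dM.ctxKind
    | _, _, _, _, _, _, .lam dM => fun i => dM.ctxKind i.succ
    | _, _, _, _, _, _, .app dM _ => dM.ctxKind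
    | _, _, _, _, _, _, .cpair dM _ => dM.ctxKind
    | _, _, _, _, _, _, .fst dM => dM.ctxKind
    | _, _, _, _, _, _, .snd dM => dM.ctxKind
    | _, _, _, _, _, _, .reflect _ _ dN => dN.ctxKind
    | _, _, _, _, _, _, .reify _ dN => dN.ctxKind
end

mutual
  /-- The type of a derivable judgement is well-kinded. -/
  def TVal.kind : {n m : ℕ} → {Γ : Ctx n m} → {V : Val m} → {A : VTy n} → TVal Γ V A →
      KVal A
    | _, _, Γ, _, .(Γ i), .var kΓ i => kΓ i
    | _, _, _, _, _, .unit _ => .unit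
    | _, _, _, _, _, .pair dV dW => .prod dV.kind dW.kind
    | _, _, _, _, _, .inj kA _ _ => kA
    | _, _, _, _, _, .thunk dM => .U dM.kind
  /-- The type and the effect of a derivable judgement are well-kinded. -/
  def TComp.kind : {n m : ℕ} → {Γ : Ctx n m} → {E : Eff n} → {M : Comp m} →
      {C : CTy n} → TComp Γ E M C → KComp E C
    | _, _, _, _, _, _, .split _ dM => dM.kind
    -- Without labels there is no branch from which the kind could be read off.
    | _, _, _, _, _, _, .case kC _ _ => kC
    | _, _, _, _, _, _, .force dV => match dV.kind with | .U kC => kC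
    | _, _, _, _, _, _, .ret kE dV => .F kE dV.kind
    | _, _, _, _, _, _, .bind _ _ dN => dN.kind
    | _, _, _, _, _, _, .lam dM => .arr (dM.ctxKind 0) dM.kind
    | _, _, _, _, _, _, .app dM _ => match dM.kind with | .arr _ kC => kC
    | _, _, _, _, _, _, .cpair dM dN => .prod dM.kind dN.kind
    | _, _, _, _, _, _, .fst dM => match dM.kind with | .prod kC _ => kC
    | _, _, _, _, _, _, .snd dM => match dM.kind with | .prod _ kD => kD
    | _, _, _, _, _, _, .reflect kT kA _ => .F kT kA
    | _, _, _, _, _, _, .reify (E := E) (.layer _ kC _ _) dN =>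
        match dN.kind with
        -- The kind of $C[A/\alpha]$ comes from that of $C$ over the extra type variable; the
        -- effect, being weakened there, returns to `E`.
        | .F _ kA => (kC.subst (kA.scons KVal.var)).cast (Eff.wk1_inst E _) rfl
end

/-! ### Renaming and substitution of term variables in derivations -/

mutual
  -- The target environment must be known to be well-kinded, since the rules for variables and the
  -- unit value record this.
  def TVal.ren : {n m k : ℕ} → {Γ : Ctx n m} → {V : Val m} → {A : VTy n} → TVal Γ V A →
      {Δ : Ctx n k} → (∀ i, KVal (Δ i)) → {ρ : Fin m → Fin k} → (∀ i, Δ (ρ i) = Γ i) →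
      TVal Δ (V.ren ρ) A
    | _, _, _, Γ, _, .(Γ i), .var _ i, _, kΔ, ρ, h => (TVal.var kΔ (ρ i)).cast rfl (h i)
    | _, _, _, _, _, _, .unit _, _, kΔ, _, _ => .unit kΔ
    | _, _, _, _, _, _, .pair dV dW, _, kΔ, _, h => .pair (dV.ren kΔ h) (dW.ren kΔ h)
    | _, _, _, _, _, _, .inj kA l dV, _, kΔ, _, h => .inj kA l (dV.ren kΔ h)
    | _, _, _, _, _, _, .thunk dM, _, kΔ, _, h => .thunk (dM.ren kΔ h)
  def TComp.ren : {n m k : ℕ} → {Γ : Ctx n m} → {E : Eff n} → {M : Comp m} → {C : CTy n} →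
      TComp Γ E M C → {Δ : Ctx n k} → (∀ i, KVal (Δ i)) → {ρ : Fin m → Fin k} →
      (∀ i, Δ (ρ i) = Γ i) → TComp Δ E (M.ren ρ) C
    | _, _, _, _, _, _, _, .split dV dM, _, kΔ, _, h =>
        .split (dV.ren kΔ h) (dM.ren
          (KVal.scons (dM.ctxKind 0) (KVal.scons (dM.ctxKind 1) kΔ))
          (Fin.cases rfl (Fin.cases rfl h)))
    | _, _, _, _, _, _, _, .case kC dV dM, _, kΔ, _, h =>
        .case kC (dV.ren kΔ h) fun l =>
          (dM l).ren (KVal.scons ((dM l).ctxKind 0) kΔ) (Fin.cases rfl h)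
    | _, _, _, _, _, _, _, .force dV, _, kΔ, _, h => .force (dV.ren kΔ h)
    | _, _, _, _, _, _, _, .ret kE dV, _, kΔ, _, h => .ret kE (dV.ren kΔ h)
    | _, _, _, _, _, _, _, .bind kE dM dN, _, kΔ, _, h =>
        .bind kE (dM.ren kΔ h) (dN.ren (KVal.scons (dN.ctxKind 0) kΔ) (Fin.cases rfl h))
    | _, _, _, _, _, _, _, .lam dM, _, kΔ, _, h =>
        .lam (dM.ren (KVal.scons (dM.ctxKind 0) kΔ) (Fin.cases rfl h))
    | _, _, _, _, _, _, _, .app dM dV, _, kΔ, _, h => .app (dM.ren kΔ h) (dV.ren kΔ h)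
    | _, _, _, _, _, _, _, .cpair dM dN, _, kΔ, _, h => .cpair (dM.ren kΔ h) (dN.ren kΔ h)
    | _, _, _, _, _, _, _, .fst dM, _, kΔ, _, h => .fst (dM.ren kΔ h)
    | _, _, _, _, _, _, _, .snd dM, _, kΔ, _, h => .snd (dM.ren kΔ h)
    | _, _, _, _, _, _, _, .reflect kT kA dN, _, kΔ, _, h => .reflect kT kA (dN.ren kΔ h)
    | _, _, _, _, _, _, _, .reify kT dN, _, kΔ, _, h => .reify kT (dN.ren kΔ h)
end

/-- Well-typed substitutions are extended by well-typed values. -/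
def TVal.scons {n m k : ℕ} {Γ : Ctx n m} {Δ : Ctx n k} {σ : Fin m → Val k} {V : Val k}
    {A : VTy n} (dV : TVal Δ V A) (dσ : ∀ i, TVal Δ (σ i) (Γ i)) :
    ∀ i, TVal Δ (scons V σ i) (LamMon.scons A Γ i) :=
  Fin.cases dV dσ

/-- Lift well-typed substitutions under a binder. -/
def TVal.liftSub {n m k : ℕ} {Γ : Ctx n m} {Δ : Ctx n k} {σ : Fin m → Val k}
    (kΔ : ∀ i, KVal (Δ i)) {A : VTy n} (kA : KVal A) (dσ : ∀ i, TVal Δ (σ i) (Γ i)) :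
    ∀ i, TVal (LamMon.scons A Δ) (liftSub σ i) (LamMon.scons A Γ i) :=
  Fin.cases (TVal.var (Γ := LamMon.scons A Δ) (kA.scons kΔ) 0)
    fun i => (dσ i).ren (kA.scons kΔ) fun _ => rfl

mutual
  def TVal.subst : {n m k : ℕ} → {Γ : Ctx n m} → {V : Val m} → {A : VTy n} → TVal Γ V A →
      {Δ : Ctx n k} → (∀ i, KVal (Δ i)) → {σ : Fin m → Val k} →
      (∀ i, TVal Δ (σ i) (Γ i)) → TVal Δ (V.subst σ) A
    | _, _, _, Γ, _, .(Γ i), .var _ i, _, _, _, h => h i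
    | _, _, _, _, _, _, .unit _, _, kΔ, _, _ => .unit kΔ
    | _, _, _, _, _, _, .pair dV dW, _, kΔ, _, h => .pair (dV.subst kΔ h) (dW.subst kΔ h)
    | _, _, _, _, _, _, .inj kA l dV, _, kΔ, _, h => .inj kA l (dV.subst kΔ h)
    | _, _, _, _, _, _, .thunk dM, _, kΔ, _, h => .thunk (dM.subst kΔ h)
  def TComp.subst : {n m k : ℕ} → {Γ : Ctx n m} → {E : Eff n} → {M : Comp m} → {C : CTy n} →
      TComp Γ E M C → {Δ : Ctx n k} → (∀ i, KVal (Δ i)) → {σ : Fin m → Val k} →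
      (∀ i, TVal Δ (σ i) (Γ i)) → TComp Δ E (M.subst σ) C
    | _, _, _, _, _, _, _, .split dV dM, _, kΔ, _, h =>
        .split (dV.subst kΔ h) (dM.subst
          (KVal.scons (dM.ctxKind 0) (KVal.scons (dM.ctxKind 1) kΔ))
          (TVal.liftSub (KVal.scons (dM.ctxKind 1) kΔ) (dM.ctxKind 0)
            (TVal.liftSub kΔ (dM.ctxKind 1) h)))
    | _, _, _, _, _, _, _, .case kC dV dM, _, kΔ, _, h =>
        .case kC (dV.subst kΔ h) fun l =>
          (dM l).subst (KVal.scons ((dM l).ctxKind 0) kΔ)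
            (TVal.liftSub kΔ ((dM l).ctxKind 0) h)
    | _, _, _, _, _, _, _, .force dV, _, kΔ, _, h => .force (dV.subst kΔ h)
    | _, _, _, _, _, _, _, .ret kE dV, _, kΔ, _, h => .ret kE (dV.subst kΔ h)
    | _, _, _, _, _, _, _, .bind kE dM dN, _, kΔ, _, h =>
        .bind kE (dM.subst kΔ h)
          (dN.subst (KVal.scons (dN.ctxKind 0) kΔ) (TVal.liftSub kΔ (dN.ctxKind 0) h))
    | _, _, _, _, _, _, _, .lam dM, _, kΔ, _, h =>
        .lam (dM.subst (KVal.scons (dM.ctxKind 0) kΔ) (TVal.liftSub kΔ (dM.ctxKind 0) h))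
    | _, _, _, _, _, _, _, .app dM dV, _, kΔ, _, h => .app (dM.subst kΔ h) (dV.subst kΔ h)
    | _, _, _, _, _, _, _, .cpair dM dN, _, kΔ, _, h =>
        .cpair (dM.subst kΔ h) (dN.subst kΔ h)
    | _, _, _, _, _, _, _, .fst dM, _, kΔ, _, h => .fst (dM.subst kΔ h)
    | _, _, _, _, _, _, _, .snd dM, _, kΔ, _, h => .snd (dM.subst kΔ h)
    | _, _, _, _, _, _, _, .reflect kT kA dN, _, kΔ, _, h =>
        .reflect kT kA (dN.subst kΔ h)
    | _, _, _, _, _, _, _, .reify kT dN, _, kΔ, _, h => .reify kT (dN.subst kΔ h)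
end

/-- Typing of `M[V/x]` -/
def TComp.subst1 {n m : ℕ} {Γ : Ctx n m} {E : Eff n} {M : Comp (m + 1)} {V : Val m}
    {A : VTy n} {C : CTy n} (dM : TComp (scons A Γ) E M C) (dV : TVal Γ V A) :
    TComp Γ E (M.subst1 V) C :=
  dM.subst dV.ctxKind (dV.scons (TVal.var dV.ctxKind))

/-! ### Subject reduction -/

/-- The hole of a closed typed frame has a type, and may be filled with computations of this type
in any environment. -/
theorem BFrame.typing {n : ℕ} {E : Eff n} {C : CTy n} (B : BFrame 0) {M : Comp 0}
    (d : TComp Ctx.nil E (B.plug M) C) :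
    ∃ D : CTy n, Nonempty (TComp Ctx.nil E M D) ∧
      ∀ {k : ℕ} {Δ : Ctx n k} (_ : ∀ i, KVal (Δ i)) (ρ : Fin 0 → Fin k) (M' : Comp k),
        TComp Δ E M' D → Nonempty (TComp Δ E ((B.ren ρ).plug M') C) := by
  cases B with
  | bind N =>
    cases d with
    | bind kE dM dN =>
      exact ⟨_, ⟨dM⟩, fun kΔ ρ M' d' => ⟨.bind kE d'
        (dN.ren (KVal.scons (dN.ctxKind 0) kΔ) (Fin.cases rfl fun i => i.elim0))⟩⟩
  | app V =>
    cases d with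
    | app dM dV =>
      exact ⟨_, ⟨dM⟩, fun kΔ ρ M' d' => ⟨.app d' (dV.ren kΔ fun i => i.elim0)⟩⟩
  | fst =>
    cases d with
    | fst dM => exact ⟨_, ⟨dM⟩, fun _ _ M' d' => ⟨.fst d'⟩⟩
  | snd =>
    cases d with
    | snd dM => exact ⟨_, ⟨dM⟩, fun _ _ M' d' => ⟨.snd d'⟩⟩

/-- The hole of a closed typed hoisting context has a type, and may be filled with computations
of this type in any environment. -/
theorem HCtx.typing {n : ℕ} {E : Eff n} {C : CTy n} : (H : HCtx 0) → {M : Comp 0} →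
    TComp Ctx.nil E (H.plug M) C →
    ∃ D : CTy n, Nonempty (TComp Ctx.nil E M D) ∧
      ∀ {k : ℕ} {Δ : Ctx n k} (_ : ∀ i, KVal (Δ i)) (ρ : Fin 0 → Fin k) (M' : Comp k),
        TComp Δ E M' D → Nonempty (TComp Δ E ((H.ren ρ).plug M') C)
  | .hole, _, d => ⟨C, ⟨d⟩, fun _ _ _ d' => ⟨d'⟩⟩
  | .push H B, _, d => by
      obtain ⟨D, ⟨dB⟩, hD⟩ := HCtx.typing H d
      obtain ⟨D', dM, hD'⟩ := B.typing dB
      exact ⟨D', dM, fun kΔ ρ M' d' => (hD' kΔ ρ M' d').elim fun d'' => hD kΔ ρ _ d''⟩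

theorem TComp.subst_monadUnit {n : ℕ} {E : Eff n} {C : CTy (n + 1)} {Nu : Comp 1}
    {V : Val 0} {A : VTy n} (du : TComp (scons (.var 0) Ctx.nil) E.wk1 Nu C)
    (dV : TVal Ctx.nil V A) :
    Nonempty (TComp Ctx.nil E (Nu.subst (scons V Fin.elim0)) (C.inst A)) := by
  have d := (du.tsubst (dV.kind.scons KVal.var)).cast (Γ' := scons A Ctx.nil)
    ((scons_comp (VTy.subst _) _ _).trans (by rw [Ctx.map_nil]; rfl)) (Eff.wk1_inst E A) rfl
  exact ⟨d.subst dV.ctxKind (dV.scons fun i => i.elim0)⟩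

/-- Instantiate $\alpha_1$ by `A` and $\alpha_2$ by `B` in the derivation of the body, then
substitute the two thunks for $y$ and $f$. -/
theorem TComp.subst_monadBind {n : ℕ} {E : Eff n} {C : CTy (n + 1)} {Nb : Comp 2}
    {N K : Comp 0} {A B : VTy n} (kA : KVal A) (kB : KVal B)
    (db : TComp (scons (.U E.wk2 C.at1)
      (scons (.U E.wk2 (.arr (.var 1) C.at2)) Ctx.nil)) E.wk2 Nb C.at2)
    (dN : TComp Ctx.nil E N (C.inst A)) (dK : TComp Ctx.nil E K (.arr A (C.inst B))) :
    Nonempty (TComp Ctx.nil E (Nb.subst (scons (.thunk N) (scons (.thunk K) Fin.elim0)))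
      (C.inst B)) := by
  have d := (db.tsubst (kB.scons (kA.scons KVal.var))).cast
    (Γ' := scons (.U E (C.inst A)) (scons (.U E (.arr A (C.inst B))) Ctx.nil))
    (by
      rw [scons_comp (VTy.subst _), scons_comp (VTy.subst _), Ctx.map_nil]
      simp only [VTy.subst, CTy.subst, Eff.wk2_inst, CTy.at1_inst, CTy.at2_inst]
      rfl)
    (Eff.wk2_inst E A B) (CTy.at2_inst C A B)
  exact ⟨d.subst dN.ctxKind ((TVal.thunk dN).scons ((TVal.thunk dK).scons fun i => i.elim0))⟩

theorem Beta.preservation {n : ℕ} {E : Eff n} {C : CTy n} {M N : Comp 0} (h : Beta M N)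
    (d : TComp Ctx.nil E M C) : Nonempty (TComp Ctx.nil E N C) := by
  cases h with
  | split V W M =>
    cases d with
    | split dV dM =>
      cases dV with
      | pair dV dW =>
        exact ⟨dM.subst dV.ctxKind (dV.scons (dW.scons fun i => i.elim0))⟩
  | case l V L M hl =>
    cases d with
    | case kC dV dM =>
      cases dV with
      | inj kA l dV => exact ⟨(dM l).subst1 dV⟩
  | force M =>
    cases d with
    | force dV =>
      cases dV with
      | thunk dM => exact ⟨dM⟩
  | bind V N =>
    cases d with
    | bind kE dM dN =>
      cases dM with
      | ret kE' dV => exact ⟨dN.subst1 dV⟩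
  | app M V =>
    cases d with
    | app dM dV =>
      cases dM with
      | lam dM => exact ⟨dM.subst1 dV⟩
  | fst M N =>
    cases d with
    | fst d =>
      cases d with
      | cpair dM dN => exact ⟨dM⟩
  | snd M N =>
    cases d with
    | snd d =>
      cases d with
      | cpair dM dN => exact ⟨dN⟩
  | reify Nu Nb V =>
    cases d with
    | reify kT dN =>
      cases dN with
      | ret kE dV =>
        cases kT with
        | layer kE kC du db => exact du.subst_monadUnit dV
  | reflect Nu Nb H N =>
    cases d with
    | reify kT dH =>
      obtain ⟨D, ⟨dr⟩, hD⟩ := HCtx.typing H dH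
      -- Basic frames do not change the effect, so the reflection in the hole is typed at the very
      -- monad being reified.
      cases dr with
      | reflect kT' kX dN =>
        have kΔ := kX.scons (σ := Ctx.nil) fun i => i.elim0
        -- The weakened context, refilled with $\mathbf{return}\,x$ for $x$ of the type of the
        -- reflection, gives the body of the continuation.
        obtain ⟨dK⟩ := hD kΔ Fin.succ _ (.ret kT (.var kΔ 0))
        cases dH.kind with
        | F _ kA =>
          have dK' := TComp.lam (.reify kT dK)
          cases kT with
          | layer kE kC du db => exact TComp.subst_monadBind kX kA db dN dK'

/-- The hypothesis is needed at all effects and types because a reification frame changes the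
effect, and every frame may change the type, between the whole computation and its hole. -/
theorem ECtx.preservation {n : ℕ} {M N : Comp 0}
    (h : ∀ (F : Eff n) (C : CTy n), TComp Ctx.nil F M C → Nonempty (TComp Ctx.nil F N C)) :
    (E : ECtx 0) → (F : Eff n) → (C : CTy n) → TComp Ctx.nil F (E.plug M) C →
      Nonempty (TComp Ctx.nil F (E.plug N) C)
  | .hole => h
  | .push E B => by
      refine ECtx.preservation (fun F C d => ?_) E
      cases B with
      | bind P => cases d with | bind kE dM dP => exact (h _ _ dM).map fun d => .bind kE d dP
      | app V => cases d with | app dM dV => exact (h _ _ dM).map fun d => .app d dV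
      | fst => cases d with | fst dM => exact (h _ _ dM).map fun d => .fst d
      | snd => cases d with | snd dM => exact (h _ _ dM).map fun d => .snd d
  | .reify E Nu Nb => by
      refine ECtx.preservation (fun F C d => ?_) E
      cases d with | reify kT dM => exact (h _ _ dM).map fun d => .reify kT d

theorem TComp.preservation {n : ℕ} {E : Eff n} {C : CTy n} {M N : Comp 0}
    (d : TComp Ctx.nil E M C) (h : Relation.ReflTransGen Step M N) :
    Nonempty (TComp Ctx.nil E N C) := by
  induction h with
  | refl => exact ⟨d⟩
  | tail _ h ih =>
    obtain ⟨F, h⟩ := h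
    exact ih.elim (ECtx.preservation (fun _ _ => h.preservation) F E C)

end LamMon

-- The termination theorem

theorem mainTheorem3 {n : ℕ} (M : LamMon.Comp 0) (A : LamMon.VTy n)
    (hM : LamMon.HasProperCType LamMon.Ctx.nil LamMon.Eff.pure M (LamMon.CTy.F A)) :
    ¬ LamMon.Diverges M ∧
      ∃! V : LamMon.Val 0, LamMon.HasVType LamMon.Ctx.nil V A ∧
        Relation.ReflTransGen LamMon.Step M (LamMon.Comp.ret V) := by
  obtain ⟨d, -⟩ := hM
  obtain ⟨V, hV⟩ := d.exists_reduces_ret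
  refine ⟨LamMon.not_diverges_of_reduces hV, V, ⟨?_, hV⟩,
    fun W hW => LamMon.reduces_ret_unique hW.2 hV⟩
  -- Subject reduction types $\mathbf{return}\,V$, and inversion of the rule types $V$.
  obtain ⟨dV⟩ := d.preservation hV
  cases dV with
  | ret kE dV => exact ⟨dV⟩
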